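/- Let $s\ge 1$ and $k\ge 0$ be fixed integers. For each $n$ let $m=m_n$ be a positive integer and let $P=P_n$ be a probability distribution on $\{0,1,\dots,m\}$. In the active random intersection graph $G_s(n,m,P)$ the vertices $v_1,\dots,v_n$ are assigned independent random subsets $D_1,\dots,D_n$ of $W=\{w_1,\dots,w_m\}$ with $\mathbb P(D_i=A)=\binom{m}{|A|}^{-1}P(|A|)$ for every $A\subseteq W$, and two distinct vertices $v_i,v_j$ are adjacent ($v_i\sim v_j$) if $|D_i\cap D_j|\ge s$. Let $X_i=|D_i|$, $a_j=\mathbb E\binom{X_1}{s}^j$ and $Z_1=\binom{m}{s}^{-1/2}n^{1/2}\binom{X_1}{s}$. Let $n\to\infty$ and $m=m_n\to\infty$, and assume that (i) $Z_1$ converges in distribution to a random variable $Z$; (ii-2) $0<\mathbb E Z^2<\infty$ and $\lim_n\mathbb E Z_1^2=\mathbb E Z^2$; and that $\binom{m}{s}n^{-1}\to\beta$ for some $\beta\in(0,\infty)$. Put $z_1=\mathbb E Z$ and $p_j=(j!)^{-1}\mathbb E\left((z_1Z)^je^{-z_1Z}\right)$ for $j=0,1,\dots$, let $d_*$ be a random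 variable with $\mathbb P(d_*=j)=p_j$, and put $\delta_1=\mathbb E d_*$ and $\overline\delta_2=\mathbb E\, d_*(d_*-1)$. Let $d(v)$ be the degree of $v$ and $d(u,v)$ the number of common neighbours of $u$ and $v$. Let $(v_1^*,v_2^*)$ be a uniformly random ordered pair of distinct vertices, independent of the graph, and put $$b=\mathbb E\left(d(v_1^*)\mid v_1^*\sim v_2^*\right),\qquad h=\mathbb E\left(d(v_1^*,v_2^*)\mid v_1^*\sim v_2^*\right),$$ $$b_j=\mathbb E\left(d(v_1^*)\mid v_1^*\sim v_2^*,\ d(v_2^*)=j\right),\qquad h_j=\mathbb E\left(d(v_1^*,v_2^*)\mid v_1^*\sim v_2^*,\ d(v_2^*)=j\right).$$ Then, as $n\to\infty$, $$b=1+\beta^{-1}a_2+o(1),\qquad h=\beta^{-1}a_1+o(1),$$ $$h_{k+1}=\frac{a_1}{\beta}\,\frac{k}{k+1}\,\frac{p_k}{p_{k+1}}+o(1),\qquad b_{k+1}=1+\beta^{-1}(a_2-a_1)+h_{k+1}+o(1),$$ and moreover $a_1=(\beta\delta_1)^{1/2}+o(1)$ and $a_2=\beta\,\overline\delta_2/\delta_1+o(1)$.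 -/

import Mathlib

open MeasureTheory ProbabilityTheory Filter Topology

namespace RIG

noncomputable section

/-! ### The active random intersection graph -/

/-- The law of one attribute set: a subset `A` of the ground set `W = Fin m` has probability
`P(|A|) / (m choose |A|)`, where `P` is a probability distribution on the sizes `0, 1, …, m`. -/
def attrWeight {m : ℕ} (P : PMF (Fin (m + 1))) (A : Finset (Fin m)) : ENNReal :=
  P ⟨A.card, Nat.lt_succ_of_le (by simpa using A.card_le_univ)⟩ / (m.choose A.card : ENNReal)

/-- The weights of all attribute sets add up to one. -/
theorem sum_attrWeight {m : ℕ} (P : PMF (Fin (m + 1))) :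
    ∑ A : Finset (Fin m), attrWeight P A = 1 := by
  classical
  have key : ∀ x : Fin (m + 1),
      ∑ A ∈ (Finset.univ : Finset (Finset (Fin m))).filter
        (fun A => (⟨A.card, Nat.lt_succ_of_le (by simpa using A.card_le_univ)⟩ : Fin (m + 1)) = x),
        attrWeight P A = P x := by
    intro x
    have hx : (x : ℕ) ≤ m := Nat.le_of_lt_succ x.2
    have hset : (Finset.univ : Finset (Finset (Fin m))).filter
        (fun A => (⟨A.card, Nat.lt_succ_of_le (by simpa using A.card_le_univ)⟩ : Fin (m + 1)) = x)
        = Finset.powersetCard (x : ℕ) (Finset.univ : Finset (Fin m)) := by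
      ext A
      simp [Finset.mem_powersetCard, Fin.ext_iff]
    have hw : ∀ A ∈ Finset.powersetCard (x : ℕ) (Finset.univ : Finset (Fin m)),
        attrWeight P A = P x / (m.choose (x : ℕ) : ENNReal) := by
      intro A hA
      have hc : A.card = (x : ℕ) := (Finset.mem_powersetCard.mp hA).2
      have hf : (⟨A.card, Nat.lt_succ_of_le (by simpa using A.card_le_univ)⟩ : Fin (m + 1)) = x :=
        Fin.ext hc
      unfold attrWeight
      rw [hf, hc]
    rw [hset, Finset.sum_congr rfl hw, Finset.sum_const, Finset.card_powersetCard,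
      Finset.card_univ, Fintype.card_fin, nsmul_eq_mul]
    exact ENNReal.mul_div_cancel (by exact_mod_cast (Nat.choose_pos hx).ne')
      (ENNReal.natCast_ne_top _)
  have hfib := Finset.sum_fiberwise (Finset.univ : Finset (Finset (Fin m)))
    (fun A => (⟨A.card, Nat.lt_succ_of_le (by simpa using A.card_le_univ)⟩ : Fin (m + 1)))
    (attrWeight P)
  rw [← hfib, Finset.sum_congr rfl (fun x _ => key x)]
  have h := P.tsum_coe
  rwa [tsum_fintype] at h

/-- The law of one attribute set, as a probability distribution on the subsets of `W`. -/
def attrLaw {m : ℕ} (P : PMF (Fin (m + 1))) : PMF (Finset (Fin m)) :=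
  PMF.ofFintype (attrWeight P) (sum_attrWeight P)

/-- The joint law of the `n` independent attribute sets `D_1, …, D_n`. -/
def setsLaw (n : ℕ) {m : ℕ} (P : PMF (Fin (m + 1))) : Measure (Fin n → Finset (Fin m)) :=
  Measure.pi fun _ => (attrLaw P).toMeasure

/-- The intersection graph of the attribute sets `D`: two distinct vertices are adjacent if they
share at least `s` attributes. -/
def graph (s : ℕ) {n m : ℕ} (D : Fin n → Finset (Fin m)) : SimpleGraph (Fin n) where
  Adj i j := i ≠ j ∧ s ≤ (D i ∩ D j).card
  symm := ⟨fun i j h => ⟨h.1.symm, by rw [Finset.inter_comm]; exact h.2⟩⟩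
  loopless := ⟨fun _ h => h.1 rfl⟩

/-! ### Averages over a random ordered pair of distinct vertices -/

/-- The degree `d(v)`. -/
def deg {n : ℕ} (G : SimpleGraph (Fin n)) (v : Fin n) : ℕ := (G.neighborSet v).ncard

/-- The number `d(u, v)` of common neighbours. -/
def codeg {n : ℕ} (G : SimpleGraph (Fin n)) (u v : Fin n) : ℕ := (G.commonNeighbors u v).ncard

/-- `E f(v₁*, v₂*)`: the expectation, over the random graph `G_s(n, m, P)` and an independent
uniformly random ordered pair of distinct vertices, of the measurement `f G v₁* v₂*`. -/
def pairMean (s n : ℕ) {m : ℕ} (P : PMF (Fin (m + 1)))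
    (f : SimpleGraph (Fin n) → Fin n → Fin n → ℝ) : ℝ :=
  ∫ D, (∑ p ∈ (Finset.univ : Finset (Fin n)).offDiag, f (graph s D) p.1 p.2) /
    ((n : ℝ) * ((n : ℝ) - 1)) ∂(setsLaw n P)

open Classical in
/-- `E* f(v₁*, v₂*)`: the conditional expectation given that `v₁* ∼ v₂*`. -/
def adjMean (s n : ℕ) {m : ℕ} (P : PMF (Fin (m + 1)))
    (f : SimpleGraph (Fin n) → Fin n → Fin n → ℝ) : ℝ :=
  pairMean s n P (fun G u v => if G.Adj u v then f G u v else 0) /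
    pairMean s n P (fun G u v => if G.Adj u v then 1 else 0)

open Classical in
/-- `E*ᵏ f(v₁*, v₂*)`: the conditional expectation given that `v₁* ∼ v₂*` and `d(v₂*) = k`. -/
def adjDegMean (s n : ℕ) {m : ℕ} (P : PMF (Fin (m + 1))) (k : ℕ)
    (f : SimpleGraph (Fin n) → Fin n → Fin n → ℝ) : ℝ :=
  pairMean s n P (fun G u v => if G.Adj u v ∧ deg G v = k then f G u v else 0) /
    pairMean s n P (fun G u v => if G.Adj u v ∧ deg G v = k then 1 else 0)

/-- `b = E* d(v₁*)`. -/
def b (s n : ℕ) {m : ℕ} (P : PMF (Fin (m + 1))) : ℝ :=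
  adjMean s n P fun G u _ => (deg G u : ℝ)

/-- `h = E* d(v₁*, v₂*)`. -/
def h (s n : ℕ) {m : ℕ} (P : PMF (Fin (m + 1))) : ℝ :=
  adjMean s n P fun G u v => (codeg G u v : ℝ)

/-- The neighbour connectivity `b_k = E*ᵏ d(v₁*)`. -/
def bDeg (s n : ℕ) {m : ℕ} (P : PMF (Fin (m + 1))) (k : ℕ) : ℝ :=
  adjDegMean s n P k fun G u _ => (deg G u : ℝ)

/-- `h_k = E*ᵏ d(v₁*, v₂*)`. -/
def hDeg (s n : ℕ) {m : ℕ} (P : PMF (Fin (m + 1))) (k : ℕ) : ℝ :=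
  adjDegMean s n P k fun G u v => (codeg G u v : ℝ)

/-! ### Joints and the asymptotic degree -/

/-- `a_i = E (X choose s)^i`, where the size `X` of an attribute set has distribution `P`. -/
def a (s : ℕ) {m : ℕ} (P : PMF (Fin (m + 1))) (i : ℕ) : ℝ :=
  ∫ x, ((x : ℕ).choose s : ℝ) ^ i ∂P.toMeasure

/-- The rescaled number of joints `Z₁ = (m choose s)^(-1/2) n^(1/2) (X choose s)`, as a function of
the size `X = x` of an attribute set. -/
def Z₁ (s n m : ℕ) (x : Fin (m + 1)) : ℝ :=
  (Real.sqrt (m.choose s))⁻¹ * Real.sqrt n * ((x : ℕ).choose s : ℝ)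

variable {Ω : Type*} [MeasurableSpace Ω]

/-- `p_k = (k!)⁻¹ E ((z₁ Z)^k e^(-z₁ Z))` with `z₁ = E Z`: the law of the asymptotic degree `d_*`. -/
def asympDeg (μ : Measure Ω) (Z : Ω → ℝ) (k : ℕ) : ℝ :=
  (k.factorial : ℝ)⁻¹ *
    ∫ ω, ((∫ ω', Z ω' ∂μ) * Z ω) ^ k * Real.exp (-((∫ ω', Z ω' ∂μ) * Z ω)) ∂μ

/-- The moment `δ_i = E d_*^i`. -/
def δ (μ : Measure Ω) (Z : Ω → ℝ) (i : ℕ) : ℝ :=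
  ∑' k : ℕ, (k : ℝ) ^ i * asympDeg μ Z k

/-- The factorial moment `E d_* (d_* - 1) ⋯ (d_* - i + 1)`. -/
def δbar (μ : Measure Ω) (Z : Ω → ℝ) (i : ℕ) : ℝ :=
  ∑' k : ℕ, (k.descFactorial i : ℝ) * asympDeg μ Z k

end

end RIG

/-!
# Clustering and neighbour connectivity in active random intersection graphs

Write `N = (m choose s)`, so that `N / n → β`, and let `Y = (X choose s)` be the number of joints
(`s`-subsets) of an attribute set of size `X`; thus `a_i = E Y ^ i`. A fixed joint lies in a random
attribute set with probability `a₁ / N`, while more than `s` prescribed attributes are contained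
in it only with probability `o(1 / N)`. Adjacencies are therefore caused by single shared joints,
and a triangle is, up to a negligible error, a joint shared by three vertices. For an attribute set
`A` with `y` joints this gives

* `N · P(B ∼ A) ≈ y a₁` (`edgeProb`),
* `N² · P(A ∼ B ∼ C) ≈ y a₂ a₁` (`pathProb`),
* `N² · P(A, B, C form a triangle) ≈ y a₁²` (`triProb`).

The estimates `edgeProb_le`, `le_edgeProb`, `pathProb_le`, `le_pathProb`, `triProb_le` and
`le_triProb` make this quantitative for every `n`: the lower bounds are Bonferroni inequalities, and
the errors are governed by `errTerm` and `pathErr`. These two tend to zero by dominated convergence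
(`Regime.tendsto_mean_zero`), because the square of the number of joints is uniformly integrable.
Averaging over `A` gives the limits of `b` and `h`.

Conditionally on the attribute sets of a vertex `v` and of two more vertices, the number of further
neighbours of `v` is binomial (`integral_setsLaw_otherDeg`), with a Poisson limit whose parameter is
`λ = z₁ Z`. Hence all averages with the constraint `d(v) = k + 1` become means of functions of the
attribute set of `v` that converge, on sets of fixed size, to multiples of `λ ^ (j + 1) e ^ (-λ) / j!`
(`Regime.tendsto_mean_of_poisBias`), and convergence in distribution of `Z₁` identifies the limits as
multiples of `(j + 1) p_{j + 1}`. Here `j = k` for the denominator and for the paths that do not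
close up to triangles, but `j = k - 1` for the triangles, which use up two neighbours of `v`; this
shift produces the factor `k / (k + 1) · p_k / p_{k + 1}`.
-/

namespace RIG

/-! ### The law of one attribute set -/

/-- The probability, as a real number, that an attribute set equals `A`. -/
noncomputable def wt {m : ℕ} (P : PMF (Fin (m + 1))) (A : Finset (Fin m)) : ℝ :=
  (attrLaw P A).toReal

/-- The expectation `E f(D)` over one random attribute set `D`, as a finite sum. -/
noncomputable def mean {m : ℕ} (P : PMF (Fin (m + 1))) (f : Finset (Fin m) → ℝ) : ℝ :=
  ∑ A, wt P A * f A

section Mean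

variable {m : ℕ} (P : PMF (Fin (m + 1)))

lemma wt_nonneg (A : Finset (Fin m)) : 0 ≤ wt P A := ENNReal.toReal_nonneg

lemma mean_eq_integral (f : Finset (Fin m) → ℝ) :
    mean P f = ∫ A, f A ∂(attrLaw P).toMeasure := by
  rw [PMF.integral_eq_sum]; rfl

lemma mean_const (c : ℝ) : mean P (fun _ => c) = c := by
  rw [mean_eq_integral]; simp

lemma mean_mono {f g : Finset (Fin m) → ℝ} (h : ∀ A, f A ≤ g A) : mean P f ≤ mean P g :=
  Finset.sum_le_sum fun A _ => mul_le_mul_of_nonneg_left (h A) (wt_nonneg P A)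

lemma mean_nonneg {f : Finset (Fin m) → ℝ} (h : ∀ A, 0 ≤ f A) : 0 ≤ mean P f :=
  Finset.sum_nonneg fun A _ => mul_nonneg (wt_nonneg P A) (h A)

lemma mean_add (f g : Finset (Fin m) → ℝ) :
    mean P (fun A => f A + g A) = mean P f + mean P g := by
  simp [mean, mul_add, Finset.sum_add_distrib]

lemma mean_sub (f g : Finset (Fin m) → ℝ) :
    mean P (fun A => f A - g A) = mean P f - mean P g := by
  simp [mean, mul_sub, Finset.sum_sub_distrib]

lemma mean_const_mul (c : ℝ) (f : Finset (Fin m) → ℝ) :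
    mean P (fun A => c * f A) = c * mean P f := by
  simp only [mean, Finset.mul_sum]
  exact Finset.sum_congr rfl fun A _ => by ring

lemma mean_mul_const (c : ℝ) (f : Finset (Fin m) → ℝ) :
    mean P (fun A => f A * c) = mean P f * c := by
  simp only [mean, Finset.sum_mul]
  exact Finset.sum_congr rfl fun A _ => by ring

lemma mean_sum {ι : Type*} (t : Finset ι) (f : ι → Finset (Fin m) → ℝ) :
    mean P (fun A => ∑ i ∈ t, f i A) = ∑ i ∈ t, mean P (f i) := by
  simp only [mean, Finset.mul_sum]
  exact Finset.sum_comm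

lemma mean_eq_sum_powersetCard (f : Finset (Fin m) → ℝ) :
    mean P f = ∑ x : Fin (m + 1), (P x).toReal / (m.choose x : ℝ) *
      ∑ A ∈ Finset.powersetCard (x : ℕ) Finset.univ, f A := by
  classical
  unfold mean
  rw [← Finset.sum_fiberwise (Finset.univ : Finset (Finset (Fin m)))
    (fun A => (⟨A.card, Nat.lt_succ_of_le (by simpa using A.card_le_univ)⟩ : Fin (m + 1)))]
  refine Finset.sum_congr rfl fun x _ => ?_
  have hset : (Finset.univ : Finset (Finset (Fin m))).filter
      (fun A => (⟨A.card, Nat.lt_succ_of_le (by simpa using A.card_le_univ)⟩ : Fin (m + 1)) = x)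
      = Finset.powersetCard (x : ℕ) (Finset.univ : Finset (Fin m)) := by
    ext A
    simp [Finset.mem_powersetCard, Fin.ext_iff]
  rw [hset, Finset.mul_sum]
  refine Finset.sum_congr rfl fun A hA => ?_
  have hc : A.card = (x : ℕ) := (Finset.mem_powersetCard.mp hA).2
  have hf : (⟨A.card, Nat.lt_succ_of_le (by simpa using A.card_le_univ)⟩ : Fin (m + 1)) = x :=
    Fin.ext hc
  congr 1
  simp [wt, attrLaw, attrWeight, hc]

lemma mean_card (g : ℕ → ℝ) :
    mean P (fun A => g A.card) = ∫ x, g x ∂P.toMeasure := by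
  rw [mean_eq_sum_powersetCard, PMF.integral_eq_sum]
  refine Finset.sum_congr rfl fun x _ => ?_
  have hx : (x : ℕ) ≤ m := Nat.le_of_lt_succ x.2
  have : (m.choose x : ℝ) ≠ 0 := by exact_mod_cast (Nat.choose_pos hx).ne'
  rw [Finset.sum_congr rfl fun A hA => by rw [(Finset.mem_powersetCard.mp hA).2]]
  simp only [Finset.sum_const, Finset.card_powersetCard, Finset.card_univ, Fintype.card_fin,
    nsmul_eq_mul, smul_eq_mul]
  field_simp

/-- Given its size `x`, an attribute set contains a fixed `t`-set with probability
`(x choose t) / (m choose t)`. -/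
lemma mean_subset (S : Finset (Fin m)) (g : ℕ → ℝ) :
    mean P (fun A => if S ⊆ A then g A.card else 0) =
      mean P (fun A => (A.card.choose S.card : ℝ) / (m.choose S.card : ℝ) * g A.card) := by
  rw [mean_eq_sum_powersetCard, mean_eq_sum_powersetCard]
  refine Finset.sum_congr rfl fun x _ => ?_
  have hx : (x : ℕ) ≤ m := Nat.le_of_lt_succ x.2
  have hS : S.card ≤ m := by simpa using S.card_le_univ
  have e1 : ∑ A ∈ Finset.powersetCard (x : ℕ) Finset.univ, (if S ⊆ A then g A.card else 0) =
      ∑ A ∈ Finset.powersetCard (x : ℕ) Finset.univ, if S ⊆ A then g x else 0 :=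
    Finset.sum_congr rfl fun A hA => by rw [(Finset.mem_powersetCard.mp hA).2]
  have e2 : ∑ A ∈ Finset.powersetCard (x : ℕ) (Finset.univ : Finset (Fin m)),
      ((A.card.choose S.card : ℝ) / (m.choose S.card : ℝ) * g A.card) =
      ∑ A ∈ Finset.powersetCard (x : ℕ) (Finset.univ : Finset (Fin m)),
        (((x : ℕ).choose S.card : ℝ) / (m.choose S.card : ℝ) * g x) :=
    Finset.sum_congr rfl fun A hA => by rw [(Finset.mem_powersetCard.mp hA).2]
  rw [e1, e2]
  rw [← Finset.sum_filter, Finset.sum_const, Finset.sum_const, Finset.card_powersetCard,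
    Finset.card_univ, Fintype.card_fin]
  simp only [nsmul_eq_mul]
  have h1 : (m.choose x : ℝ) ≠ 0 := by exact_mod_cast (Nat.choose_pos hx).ne'
  have h2 : (m.choose S.card : ℝ) ≠ 0 := by exact_mod_cast (Nat.choose_pos hS).ne'
  rcases le_or_gt S.card x with hsx | hsx
  · rw [Finset.card_filter_powersetCard_subset S Finset.univ x (Finset.subset_univ S) hsx,
      Finset.card_univ, Fintype.card_fin]
    have h3 : (m.choose x : ℝ) * ((x : ℕ).choose S.card : ℝ) =
        (m.choose S.card : ℝ) * ((m - S.card).choose (x - S.card) : ℝ) := by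
      exact_mod_cast Nat.choose_mul hsx
    field_simp
    linear_combination -(P x).toReal * g x * h3
  · rw [Nat.choose_eq_zero_of_lt hsx, Finset.filter_false_of_mem]
    · simp
    · intro A hA hSA
      have := Finset.card_le_card hSA
      rw [(Finset.mem_powersetCard.mp hA).2] at this
      omega

end Mean

/-! ### Joints and adjacency of attribute sets -/

/-- The number of `s`-subsets ("joints") of an attribute set, as a real number. -/
def joints (s : ℕ) {m : ℕ} (A : Finset (Fin m)) : ℝ := (A.card.choose s : ℝ)

/-- The indicator that two attribute sets share at least `s` attributes. -/
def adjInd (s : ℕ) {m : ℕ} (A B : Finset (Fin m)) : ℝ := if s ≤ (A ∩ B).card then 1 else 0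

/-- The indicator that `B` contains `S`. -/
def subInd {m : ℕ} (S B : Finset (Fin m)) : ℝ := if S ⊆ B then 1 else 0

/-- The quantity `(m choose s) P(U ⊆ D ∣ |D| = x)` for a set `U` of size `s + 1`, that is,
`(x choose s) (x - s) / (m - s)`; the natural-number subtraction in the numerator is harmless
because `x choose s` vanishes for `x < s`. It is at most `x choose s`, and it is negligible for
bounded `x`. -/
noncomputable def excess (s m x : ℕ) : ℝ := (x.choose s : ℝ) * ((x - s : ℕ) : ℝ) / ((m - s : ℕ) : ℝ)

section Indicators

variable {m : ℕ} (s : ℕ)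

lemma joints_nonneg (A : Finset (Fin m)) : 0 ≤ joints s A := Nat.cast_nonneg _

lemma joints_le_sq (A : Finset (Fin m)) : joints s A ≤ joints s A ^ 2 := by
  unfold joints
  exact_mod_cast Nat.le_self_pow two_ne_zero _

lemma adjInd_nonneg (A B : Finset (Fin m)) : 0 ≤ adjInd s A B := by
  unfold adjInd; split_ifs <;> norm_num

lemma adjInd_le_one (A B : Finset (Fin m)) : adjInd s A B ≤ 1 := by
  unfold adjInd; split_ifs <;> norm_num

lemma adjInd_comm (A B : Finset (Fin m)) : adjInd s A B = adjInd s B A := by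
  simp only [adjInd, Finset.inter_comm]

lemma subInd_nonneg (S B : Finset (Fin m)) : 0 ≤ subInd S B := by
  unfold subInd; split_ifs <;> norm_num

lemma subInd_le_one (S B : Finset (Fin m)) : subInd S B ≤ 1 := by
  unfold subInd; split_ifs <;> norm_num

lemma subInd_union (S T B : Finset (Fin m)) : subInd (S ∪ T) B = subInd S B * subInd T B := by
  unfold subInd
  simp only [Finset.union_subset_iff]
  split_ifs <;> simp_all

lemma subInd_inter (S B C : Finset (Fin m)) : subInd S (B ∩ C) = subInd S B * subInd S C := by
  unfold subInd
  simp only [Finset.subset_inter_iff]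
  split_ifs <;> simp_all

lemma card_powersetCard_eq_joints (A : Finset (Fin m)) :
    ((Finset.powersetCard s A).card : ℝ) = joints s A := by
  rw [Finset.card_powersetCard]; rfl

lemma sum_subInd (A B : Finset (Fin m)) :
    ∑ S ∈ Finset.powersetCard s A, subInd S B = ((A ∩ B).card.choose s : ℝ) := by
  unfold subInd
  rw [← Finset.sum_filter, Finset.sum_const, nsmul_one, ← Finset.card_powersetCard]
  congr 2
  ext S
  simp only [Finset.mem_filter, Finset.mem_powersetCard, Finset.subset_inter_iff]
  tauto

lemma adjInd_le_sum (A B : Finset (Fin m)) :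
    adjInd s A B ≤ ∑ S ∈ Finset.powersetCard s A, subInd S B := by
  rw [sum_subInd]
  unfold adjInd
  split_ifs with h
  · exact_mod_cast Nat.choose_pos h
  · positivity

/-- A Bonferroni inequality: the number of common joints, minus the number of ordered pairs of
distinct ones, is at most the adjacency indicator. -/
lemma sum_sub_sum_offDiag_le_adjInd (A B : Finset (Fin m)) :
    ∑ S ∈ Finset.powersetCard s A, subInd S B -
      ∑ p ∈ (Finset.powersetCard s A).offDiag, subInd (p.1 ∪ p.2) B ≤ adjInd s A B := by
  have h1 : ∑ p ∈ (Finset.powersetCard s A).offDiag, subInd (p.1 ∪ p.2) B =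
      ((A ∩ B).card.choose s : ℝ) ^ 2 - ((A ∩ B).card.choose s : ℝ) := by
    have hsq : ∀ S : Finset (Fin m), subInd S B * subInd S B = subInd S B := fun S => by
      unfold subInd; split_ifs <;> simp
    have := Finset.sum_mul_sum (Finset.powersetCard s A) (Finset.powersetCard s A)
      (fun S => subInd S B) (fun S => subInd S B)
    rw [← Finset.sum_product', ← Finset.diag_union_offDiag,
      Finset.sum_union (Finset.disjoint_diag_offDiag _), Finset.sum_diag,
      Finset.sum_congr rfl fun S _ => hsq S, sum_subInd] at this
    rw [Finset.sum_congr rfl fun p _ => subInd_union p.1 p.2 B]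
    linarith
  rw [h1, sum_subInd]
  unfold adjInd
  split_ifs with h
  · nlinarith [sq_nonneg (((A ∩ B).card.choose s : ℝ) - 1)]
  · rw [Nat.choose_eq_zero_of_lt (not_le.mp h)]; simp

lemma card_lt_card_union {A S T : Finset (Fin m)} (hS : S ∈ Finset.powersetCard s A)
    {A' : Finset (Fin m)} (hT : T ∈ Finset.powersetCard s A') (hne : S ≠ T) :
    s + 1 ≤ (S ∪ T).card := by
  rw [Finset.mem_powersetCard] at hS hT
  by_contra hlt
  have h1 : S = S ∪ T := Finset.eq_of_subset_of_card_le Finset.subset_union_left (by omega)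
  have h2 : T = S ∪ T := Finset.eq_of_subset_of_card_le Finset.subset_union_right (by omega)
  exact hne (h1.trans h2.symm)

lemma excess_nonneg (m x : ℕ) : 0 ≤ excess s m x := by unfold excess; positivity

lemma excess_le {m x : ℕ} (hx : x ≤ m) : excess s m x ≤ (x.choose s : ℝ) := by
  unfold excess
  rw [mul_div_assoc]
  refine mul_le_of_le_one_right (by positivity) (div_le_one_of_le₀ ?_ (by positivity))
  exact_mod_cast Nat.sub_le_sub_right hx s

lemma excess_le_joints (A : Finset (Fin m)) : excess s m A.card ≤ joints s A :=
  excess_le s (by simpa using A.card_le_univ)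

end Indicators

section Containment

variable {m : ℕ} (s : ℕ) (P : PMF (Fin (m + 1)))

lemma mean_subInd_mul {S : Finset (Fin m)} (hS : S.card = s) (g : ℕ → ℝ) :
    mean P (fun B => subInd S B * g B.card) =
      mean P (fun B => joints s B * g B.card) / (m.choose s : ℝ) := by
  have := mean_subset P S g
  rw [hS] at this
  rw [div_eq_mul_inv, ← mean_mul_const]
  calc _ = mean P (fun A => if S ⊆ A then g A.card else 0) := by simp [subInd, mean]
    _ = _ := this
    _ = _ := by unfold joints; congr 1; funext B; ring

lemma mean_subInd_mul_le {U : Finset (Fin m)} (hU : s + 1 ≤ U.card) {g : ℕ → ℝ}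
    (hg : ∀ x, 0 ≤ g x) :
    mean P (fun B => subInd U B * g B.card) ≤
      mean P (fun B => excess s m B.card * g B.card) / (m.choose s : ℝ) := by
  obtain ⟨V, hVU, hV⟩ := Finset.exists_subset_card_eq hU
  have hm : s + 1 ≤ m := hU.trans (by simpa using U.card_le_univ)
  have h1 : (m.choose s : ℝ) ≠ 0 := by exact_mod_cast (Nat.choose_pos (by omega)).ne'
  have h2 : (m.choose (s + 1) : ℝ) ≠ 0 := by exact_mod_cast (Nat.choose_pos (by omega)).ne'
  have h3 : ((m - s : ℕ) : ℝ) ≠ 0 := by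
    have : m - s ≠ 0 := by omega
    exact_mod_cast this
  calc mean P (fun B => subInd U B * g B.card)
      ≤ mean P (fun B => if V ⊆ B then g B.card else 0) := by
        refine mean_mono P fun B => ?_
        unfold subInd
        split_ifs with h h' h'
        · simp
        · exact absurd (hVU.trans h) h'
        · simpa using hg _
        · simp
    _ = mean P (fun A => (A.card.choose (s + 1) : ℝ) / (m.choose (s + 1) : ℝ) * g A.card) := by
        rw [mean_subset, hV]
    _ = mean P (fun B => excess s m B.card * g B.card) / (m.choose s : ℝ) := by
        rw [div_eq_mul_inv, ← mean_mul_const]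
        congr 1
        funext B
        have e1 : (m.choose (s + 1) : ℝ) * (s + 1) = (m.choose s : ℝ) * ((m - s : ℕ) : ℝ) := by
          exact_mod_cast Nat.choose_succ_right_eq m s
        have e2 : (B.card.choose (s + 1) : ℝ) * (s + 1) =
            (B.card.choose s : ℝ) * ((B.card - s : ℕ) : ℝ) := by
          exact_mod_cast Nat.choose_succ_right_eq B.card s
        have e3 : (B.card.choose (s + 1) : ℝ) / (m.choose (s + 1) : ℝ) =
            (B.card.choose s : ℝ) * ((B.card - s : ℕ) : ℝ) /
              ((m.choose s : ℝ) * ((m - s : ℕ) : ℝ)) := by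
          rw [← e1, ← e2]
          have : (s : ℝ) + 1 ≠ 0 := by positivity
          field_simp
        rw [e3]
        unfold excess
        field_simp

end Containment

/-! ### Edges, paths and triangles at a fixed attribute set -/

section Local

variable {m : ℕ} (s : ℕ) (P : PMF (Fin (m + 1)))

/-- The probability that a random attribute set is adjacent to `A`. -/
noncomputable def edgeProb (A : Finset (Fin m)) : ℝ := mean P fun B => adjInd s A B

/-- The probability that two independent random attribute sets `B`, `C` form a path `A ∼ B ∼ C`. -/
noncomputable def pathProb (A : Finset (Fin m)) : ℝ :=
  mean P fun B => mean P fun C => adjInd s A B * adjInd s B C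

/-- The probability that two independent random attribute sets form a triangle with `A`. -/
noncomputable def triProb (A : Finset (Fin m)) : ℝ :=
  mean P fun B => mean P fun C => adjInd s A B * adjInd s A C * adjInd s B C

/-- The error term `η = E (joints · excess)`: up to the factor `(m choose s)⁻¹`, it bounds the
probability of containing a given set of more than `s` attributes. -/
noncomputable def errTerm : ℝ := mean P fun B => joints s B * excess s m B.card

/-- The error term `E (joints · min (joints · a₁, joints² · η))`, which controls paths. -/
noncomputable def pathErr : ℝ :=
  mean P fun B => joints s B * min (joints s B * a s P 1) (joints s B ^ 2 * errTerm s P)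

lemma a_eq_mean (i : ℕ) : a s P i = mean P fun A => joints s A ^ i := by
  unfold a
  rw [← mean_card P fun x => ((x.choose s : ℕ) : ℝ) ^ i]; rfl

lemma a_one_eq_mean : a s P 1 = mean P fun A => joints s A := by simp [a_eq_mean]

lemma a_nonneg (i : ℕ) : 0 ≤ a s P i := by
  rw [a_eq_mean]; exact mean_nonneg P fun A => pow_nonneg (joints_nonneg s A) i

lemma errTerm_nonneg : 0 ≤ errTerm s P :=
  mean_nonneg P fun A => mul_nonneg (joints_nonneg s A) (excess_nonneg s m _)

lemma mean_excess_le : mean P (fun B => excess s m B.card) ≤ errTerm s P := by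
  refine mean_mono P fun B => ?_
  by_cases h : B.card.choose s = 0
  · simp [excess, h]
  · have h1 : 1 ≤ joints s B := by
      unfold joints; exact_mod_cast Nat.one_le_iff_ne_zero.mpr h
    exact le_mul_of_one_le_left (excess_nonneg s m _) h1

lemma edgeProb_nonneg (A : Finset (Fin m)) : 0 ≤ edgeProb s P A :=
  mean_nonneg P fun B => adjInd_nonneg s A B

lemma edgeProb_le_one (A : Finset (Fin m)) : edgeProb s P A ≤ 1 :=
  (mean_mono P fun B => adjInd_le_one s A B).trans_eq (mean_const P 1)

lemma mean_subInd {S : Finset (Fin m)} (hS : S.card = s) :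
    mean P (fun B => subInd S B) = a s P 1 / (m.choose s : ℝ) := by
  simpa [a_one_eq_mean] using mean_subInd_mul s P hS fun _ => 1

lemma mean_subInd_le {U : Finset (Fin m)} (hU : s + 1 ≤ U.card) :
    mean P (fun B => subInd U B) ≤ errTerm s P / (m.choose s : ℝ) := by
  have := mean_subInd_mul_le s P hU (g := fun _ => 1) fun _ => zero_le_one
  simp only [mul_one] at this
  exact this.trans (div_le_div_of_nonneg_right (mean_excess_le s P) (by positivity))

lemma sum_offDiag_le {A : Finset (Fin m)} {c : ℝ} (hc : 0 ≤ c)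
    (f : Finset (Fin m) × Finset (Fin m) → ℝ)
    (hf : ∀ p ∈ (Finset.powersetCard s A).offDiag, f p ≤ c) :
    ∑ p ∈ (Finset.powersetCard s A).offDiag, f p ≤ joints s A ^ 2 * c := by
  refine (Finset.sum_le_card_nsmul _ _ _ hf).trans ?_
  rw [nsmul_eq_mul]
  refine mul_le_mul_of_nonneg_right ?_ hc
  rw [← card_powersetCard_eq_joints, sq]
  rw [Finset.offDiag_card]
  exact_mod_cast Nat.sub_le _ _

lemma mean_adjInd_mul_le (A : Finset (Fin m)) {g : ℕ → ℝ} (hg : ∀ x, 0 ≤ g x) :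
    mean P (fun B => adjInd s A B * g B.card) ≤
      joints s A * (mean P (fun B => joints s B * g B.card) / (m.choose s : ℝ)) := by
  calc mean P (fun B => adjInd s A B * g B.card)
      ≤ mean P (fun B => ∑ S ∈ Finset.powersetCard s A, subInd S B * g B.card) := by
        refine mean_mono P fun B => ?_
        rw [← Finset.sum_mul]
        exact mul_le_mul_of_nonneg_right (adjInd_le_sum s A B) (hg _)
    _ = _ := by
        rw [mean_sum, Finset.sum_congr rfl fun S hS =>
          mean_subInd_mul s P (Finset.mem_powersetCard.mp hS).2 g, Finset.sum_const, nsmul_eq_mul,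
          card_powersetCard_eq_joints]

lemma le_mean_adjInd_mul (A : Finset (Fin m)) {g : ℕ → ℝ} (hg : ∀ x, 0 ≤ g x) :
    joints s A * (mean P (fun B => joints s B * g B.card) / (m.choose s : ℝ)) -
      joints s A ^ 2 * (mean P (fun B => excess s m B.card * g B.card) / (m.choose s : ℝ)) ≤
      mean P (fun B => adjInd s A B * g B.card) := by
  have h1 : mean P (fun B => ∑ S ∈ Finset.powersetCard s A, subInd S B * g B.card) =
      joints s A * (mean P (fun B => joints s B * g B.card) / (m.choose s : ℝ)) := by
    rw [mean_sum, Finset.sum_congr rfl fun S hS =>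
      mean_subInd_mul s P (Finset.mem_powersetCard.mp hS).2 g, Finset.sum_const, nsmul_eq_mul,
      card_powersetCard_eq_joints]
  have h2 : mean P (fun B => ∑ p ∈ (Finset.powersetCard s A).offDiag,
        subInd (p.1 ∪ p.2) B * g B.card) ≤
      joints s A ^ 2 * (mean P (fun B => excess s m B.card * g B.card) / (m.choose s : ℝ)) := by
    rw [mean_sum]
    refine sum_offDiag_le s (div_nonneg (mean_nonneg P fun B =>
      mul_nonneg (excess_nonneg s m _) (hg _)) (by positivity)) _ fun p hp => ?_
    rw [Finset.mem_offDiag] at hp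
    exact mean_subInd_mul_le s P (card_lt_card_union s hp.1 hp.2.1 hp.2.2) hg
  have h3 := mean_mono P fun B => mul_le_mul_of_nonneg_right
    (sum_sub_sum_offDiag_le_adjInd s A B) (hg B.card)
  simp only [sub_mul, Finset.sum_mul] at h3
  rw [mean_sub] at h3
  linarith

lemma edgeProb_le (A : Finset (Fin m)) :
    edgeProb s P A ≤ joints s A * (a s P 1 / (m.choose s : ℝ)) := by
  simpa [edgeProb, a_one_eq_mean] using
    mean_adjInd_mul_le s P A (g := fun _ => 1) fun _ => zero_le_one

lemma le_edgeProb (A : Finset (Fin m)) :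
    joints s A * (a s P 1 / (m.choose s : ℝ)) -
      joints s A ^ 2 * (errTerm s P / (m.choose s : ℝ)) ≤ edgeProb s P A := by
  have := le_mean_adjInd_mul s P A (g := fun _ => 1) fun _ => zero_le_one
  simp only [mul_one] at this
  rw [← a_one_eq_mean] at this
  refine le_trans (sub_le_sub_left ?_ _) this
  gcongr
  exact mean_excess_le s P

lemma pathProb_eq (A : Finset (Fin m)) :
    pathProb s P A = mean P fun B => adjInd s A B * edgeProb s P B := by
  simp only [pathProb, mean_const_mul, edgeProb]

lemma pathProb_le (A : Finset (Fin m)) :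
    pathProb s P A ≤ joints s A * (a s P 2 * a s P 1 / (m.choose s : ℝ) ^ 2) := by
  rw [pathProb_eq]
  have h := mean_adjInd_mul_le s P A (g := fun x => (x.choose s : ℝ) * (a s P 1 / (m.choose s : ℝ)))
    fun x => mul_nonneg (by positivity) (div_nonneg (a_nonneg s P 1) (by positivity))
  refine (mean_mono P fun B => mul_le_mul_of_nonneg_left (edgeProb_le s P B)
    (adjInd_nonneg s A B)).trans (h.trans_eq ?_)
  have : mean P (fun B => joints s B * ((B.card.choose s : ℝ) * (a s P 1 / (m.choose s : ℝ)))) =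
      a s P 2 * (a s P 1 / (m.choose s : ℝ)) := by
    rw [a_eq_mean s P 2, ← mean_mul_const]
    congr 1; funext B; unfold joints; ring
  rw [this]; ring

/-- The defect of the union bound for `edgeProb` at `B` is at most
`min (joints · a₁, joints² · η) / (m choose s)`; averaged over the neighbours `B` of `A` this is
governed by `pathErr`. -/
lemma le_pathProb (A : Finset (Fin m)) :
    joints s A * (a s P 2 * a s P 1 / (m.choose s : ℝ) ^ 2) -
      joints s A ^ 2 * (errTerm s P * a s P 1 / (m.choose s : ℝ) ^ 2) -
      joints s A * (pathErr s P / (m.choose s : ℝ) ^ 2) ≤ pathProb s P A := by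
  set N : ℝ := (m.choose s : ℝ) with hN
  have hN0 : 0 ≤ N := by positivity
  have ha := a_nonneg s P 1
  have he := errTerm_nonneg s P
  have h1 := le_mean_adjInd_mul s P A (g := fun x => (x.choose s : ℝ) * (a s P 1 / N))
    fun x => mul_nonneg (by positivity) (div_nonneg ha hN0)
  have h2 := mean_adjInd_mul_le s P A
    (g := fun x => min ((x.choose s : ℝ) * a s P 1) ((x.choose s : ℝ) ^ 2 * errTerm s P) / N)
    fun x => div_nonneg (le_min (by positivity) (by positivity)) hN0
  have e1 : mean P (fun B => joints s B * ((B.card.choose s : ℝ) * (a s P 1 / N))) =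
      a s P 2 * (a s P 1 / N) := by
    rw [a_eq_mean s P 2, ← mean_mul_const]
    congr 1; funext B; unfold joints; ring
  have e2 : mean P (fun B => excess s m B.card * ((B.card.choose s : ℝ) * (a s P 1 / N))) =
      errTerm s P * (a s P 1 / N) := by
    rw [errTerm, ← mean_mul_const]
    congr 1; funext B; unfold joints; ring
  have e3 : mean P (fun B => joints s B *
      (min ((B.card.choose s : ℝ) * a s P 1) ((B.card.choose s : ℝ) ^ 2 * errTerm s P) / N)) =
      pathErr s P / N := by
    rw [pathErr, div_eq_mul_inv, ← mean_mul_const]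
    congr 1; funext B; unfold joints; ring
  rw [← hN, e1, e2] at h1
  rw [← hN, e3] at h2
  have h3 : ∀ B, adjInd s A B * ((B.card.choose s : ℝ) * (a s P 1 / N)) -
      adjInd s A B *
        (min ((B.card.choose s : ℝ) * a s P 1) ((B.card.choose s : ℝ) ^ 2 * errTerm s P) / N) ≤
      adjInd s A B * edgeProb s P B := by
    intro B
    rw [← mul_sub]
    refine mul_le_mul_of_nonneg_left ?_ (adjInd_nonneg s A B)
    rcases min_choice ((B.card.choose s : ℝ) * a s P 1)
      ((B.card.choose s : ℝ) ^ 2 * errTerm s P) with h | h <;> rw [h]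
    · rw [mul_div_assoc, sub_self]; exact edgeProb_nonneg s P B
    · have := le_edgeProb s P B
      unfold joints at this
      rwa [← hN, ← mul_div_assoc (_ ^ 2)] at this
  have h4 := mean_mono P h3
  rw [mean_sub] at h4
  rw [pathProb_eq]
  have r1 : joints s A * (a s P 2 * (a s P 1 / N) / N) =
    joints s A * (a s P 2 * a s P 1 / N ^ 2) := by ring
  have r2 : joints s A ^ 2 * (errTerm s P * (a s P 1 / N) / N) =
    joints s A ^ 2 * (errTerm s P * a s P 1 / N ^ 2) := by ring
  have r3 : joints s A * (pathErr s P / N / N) = joints s A * (pathErr s P / N ^ 2) := by ring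
  linarith

lemma triProb_nonneg (A : Finset (Fin m)) : 0 ≤ triProb s P A :=
  mean_nonneg P fun B => mean_nonneg P fun C => mul_nonneg
    (mul_nonneg (adjInd_nonneg s A B) (adjInd_nonneg s A C)) (adjInd_nonneg s B C)

lemma triProb_le_pathProb (A : Finset (Fin m)) : triProb s P A ≤ pathProb s P A :=
  mean_mono P fun B => mean_mono P fun C => mul_le_mul_of_nonneg_right
    (mul_le_of_le_one_right (adjInd_nonneg s A B) (adjInd_le_one s A C)) (adjInd_nonneg s B C)

/-- Two neighbours of `A` containing the same joint of `A` are adjacent. -/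
lemma le_triProb (A : Finset (Fin m)) :
    joints s A * (a s P 1 / (m.choose s : ℝ)) ^ 2 -
      joints s A ^ 2 * (errTerm s P / (m.choose s : ℝ)) ^ 2 ≤ triProb s P A := by
  have hkey : ∀ B C : Finset (Fin m),
      ∑ S ∈ Finset.powersetCard s A, subInd S B * subInd S C -
        ∑ p ∈ (Finset.powersetCard s A).offDiag, subInd (p.1 ∪ p.2) B * subInd (p.1 ∪ p.2) C ≤
        adjInd s A B * adjInd s A C * adjInd s B C := by
    intro B C
    have h := sum_sub_sum_offDiag_le_adjInd s A (B ∩ C)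
    simp only [subInd_inter] at h
    refine h.trans ?_
    unfold adjInd
    by_cases hc : s ≤ (A ∩ (B ∩ C)).card
    · have h1 : s ≤ (A ∩ B).card := hc.trans (Finset.card_le_card (by grind))
      have h2 : s ≤ (A ∩ C).card := hc.trans (Finset.card_le_card (by grind))
      have h3 : s ≤ (B ∩ C).card := hc.trans (Finset.card_le_card (by grind))
      simp [hc, h1, h2, h3]
    · rw [if_neg hc]
      split_ifs <;> simp
  have h := mean_mono P fun B => mean_mono P fun C => hkey B C
  simp only [mean_sub, mean_sum, mean_const_mul, mean_mul_const] at h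
  refine le_trans (sub_le_sub (le_of_eq ?_) ?_) h
  · rw [Finset.sum_congr rfl fun S hS => by rw [mean_subInd s P (Finset.mem_powersetCard.mp hS).2],
      Finset.sum_const, nsmul_eq_mul, card_powersetCard_eq_joints, sq]
  · refine sum_offDiag_le s (sq_nonneg _) _ fun p hp => ?_
    rw [Finset.mem_offDiag] at hp
    have := mean_subInd_le s P (card_lt_card_union s hp.1 hp.2.1 hp.2.2)
    rw [sq]
    exact mul_le_mul this this (mean_nonneg P fun B => subInd_nonneg _ B)
      (div_nonneg (errTerm_nonneg s P) (by positivity))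

/-- A triangle on `A`, `B`, `C` has either a joint of `A` shared by `B` and `C`, or distinct joints
`S ⊆ A ∩ B` and `S' ⊆ A ∩ C`. In the latter case `B` contains `S'` too, or `C` contains `S'`
together with a further joint of `B`; both are rare, since more than `s` prescribed attributes are
involved. -/
lemma triProb_le (A : Finset (Fin m)) :
    triProb s P A ≤ joints s A * (a s P 1 / (m.choose s : ℝ)) ^ 2 +
      joints s A ^ 2 * ((a s P 1 + a s P 2) * errTerm s P / (m.choose s : ℝ) ^ 2) := by
  set N : ℝ := (m.choose s : ℝ) with hN
  have hN0 : 0 ≤ N := by positivity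
  have he := errTerm_nonneg s P
  have ha1 := a_nonneg s P 1
  have ha2 := a_nonneg s P 2
  have hclose : ∀ S' B C : Finset (Fin m), S'.card = s →
      subInd S' C * adjInd s B C ≤ subInd S' B * subInd S' C +
        ∑ T ∈ (Finset.powersetCard s B).erase S', subInd (S' ∪ T) C := by
    intro S' B C hS'
    have h1 : subInd S' C * adjInd s B C ≤
        subInd S' C * ∑ T ∈ Finset.powersetCard s B, subInd T C :=
      mul_le_mul_of_nonneg_left (adjInd_le_sum s B C) (subInd_nonneg _ _)
    refine h1.trans ?_
    simp only [subInd_union, ← Finset.mul_sum]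
    by_cases hSB : S' ⊆ B
    · rw [← Finset.add_sum_erase _ _ (Finset.mem_powersetCard.mpr ⟨hSB, hS'⟩), mul_add]
      refine add_le_add_left ?_ _
      have : subInd S' B = 1 := if_pos hSB
      rw [this, one_mul]
      exact mul_le_of_le_one_right (subInd_nonneg _ _) (subInd_le_one _ _)
    · rw [Finset.erase_eq_of_notMem fun h => hSB (Finset.mem_powersetCard.mp h).1]
      exact le_add_of_nonneg_left (mul_nonneg (subInd_nonneg _ _) (subInd_nonneg _ _))
  have hkey : ∀ B C : Finset (Fin m), adjInd s A B * adjInd s A C * adjInd s B C ≤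
      ∑ S ∈ Finset.powersetCard s A, subInd S B * subInd S C +
        ∑ p ∈ (Finset.powersetCard s A).offDiag, (subInd (p.1 ∪ p.2) B * subInd p.2 C +
          subInd p.1 B * ∑ T ∈ (Finset.powersetCard s B).erase p.2, subInd (p.2 ∪ T) C) := by
    intro B C
    calc adjInd s A B * adjInd s A C * adjInd s B C
        ≤ (∑ S ∈ Finset.powersetCard s A, subInd S B) *
            (∑ S ∈ Finset.powersetCard s A, subInd S C) * adjInd s B C := by
          refine mul_le_mul_of_nonneg_right ?_ (adjInd_nonneg s B C)
          exact mul_le_mul (adjInd_le_sum s A B) (adjInd_le_sum s A C) (adjInd_nonneg s A C)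
            (Finset.sum_nonneg fun S _ => subInd_nonneg S B)
      _ = ∑ S ∈ Finset.powersetCard s A, subInd S B * subInd S C * adjInd s B C +
            ∑ p ∈ (Finset.powersetCard s A).offDiag,
              subInd p.1 B * subInd p.2 C * adjInd s B C := by
          rw [Finset.sum_mul_sum, ← Finset.sum_product', ← Finset.diag_union_offDiag,
            Finset.sum_union (Finset.disjoint_diag_offDiag _), Finset.sum_diag, add_mul,
            Finset.sum_mul, Finset.sum_mul]
      _ ≤ _ := by
          refine add_le_add (Finset.sum_le_sum fun S _ => ?_) (Finset.sum_le_sum fun p hp => ?_)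
          · exact mul_le_of_le_one_right (mul_nonneg (subInd_nonneg _ _) (subInd_nonneg _ _))
              (adjInd_le_one s B C)
          · rw [Finset.mem_offDiag] at hp
            rw [subInd_union, mul_assoc, mul_assoc, ← mul_add]
            exact mul_le_mul_of_nonneg_left
              (hclose p.2 B C (Finset.mem_powersetCard.mp hp.2.1).2) (subInd_nonneg _ _)
  have h := mean_mono P fun B => mean_mono P fun C => hkey B C
  simp only [mean_sum, mean_add, mean_const_mul, mean_mul_const] at h
  refine h.trans (add_le_add (le_of_eq ?_) ?_)
  · rw [Finset.sum_congr rfl fun S hS => by rw [mean_subInd s P (Finset.mem_powersetCard.mp hS).2],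
      Finset.sum_const, nsmul_eq_mul, card_powersetCard_eq_joints, sq]
  · refine sum_offDiag_le s (by positivity) _ fun p hp => ?_
    rw [Finset.mem_offDiag] at hp
    have h1 : mean P (fun B => subInd (p.1 ∪ p.2) B) * mean P (fun C => subInd p.2 C) ≤
        errTerm s P / N * (a s P 1 / N) := by
      rw [mean_subInd s P (Finset.mem_powersetCard.mp hp.2.1).2]
      exact mul_le_mul_of_nonneg_right
        (mean_subInd_le s P (card_lt_card_union s hp.1 hp.2.1 hp.2.2)) (by positivity)
    have h2 : mean P (fun B => subInd p.1 B *
        ∑ T ∈ (Finset.powersetCard s B).erase p.2, mean P fun C => subInd (p.2 ∪ T) C) ≤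
        a s P 2 / N * (errTerm s P / N) := by
      have h3 : ∀ B : Finset (Fin m), subInd p.1 B *
          ∑ T ∈ (Finset.powersetCard s B).erase p.2, mean P (fun C => subInd (p.2 ∪ T) C) ≤
          subInd p.1 B * (B.card.choose s : ℝ) * (errTerm s P / N) := by
        intro B
        rw [mul_assoc]
        refine mul_le_mul_of_nonneg_left ?_ (subInd_nonneg _ _)
        refine (Finset.sum_le_card_nsmul _ _ (errTerm s P / N) fun T hT => ?_).trans ?_
        · rw [Finset.mem_erase] at hT
          exact mean_subInd_le s P (card_lt_card_union s hp.2.1 hT.2 hT.1.symm)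
        · rw [nsmul_eq_mul]
          refine mul_le_mul_of_nonneg_right ?_ (by positivity)
          rw [← Finset.card_powersetCard]
          exact_mod_cast Finset.card_erase_le
      refine (mean_mono P h3).trans_eq ?_
      rw [mean_mul_const, mean_subInd_mul s P (Finset.mem_powersetCard.mp hp.1).2
        (fun x => (x.choose s : ℝ)), a_eq_mean]
      congr 3
      funext B; unfold joints; ring
    refine (add_le_add h1 h2).trans_eq ?_
    ring

end Local

/-! ### Independence of the attribute sets: averages over three vertices -/

/-- The binomial point probability `P(Bin(N, q) = j)`. -/
noncomputable def bin (N : ℕ) (q : ℝ) (j : ℕ) : ℝ := (N.choose j : ℝ) * q ^ j * (1 - q) ^ (N - j)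

/-- The binomial point probability `P(Bin(N, q) + 1 = j)`. -/
noncomputable def binPrev (N : ℕ) (q : ℝ) : ℕ → ℝ
  | 0 => 0
  | j + 1 => bin N q j

section Factorization

variable {n m : ℕ} (s : ℕ) (P : PMF (Fin (m + 1)))

instance : IsProbabilityMeasure (setsLaw n P) := by unfold setsLaw; infer_instance

lemma integrable_setsLaw (f : (Fin n → Finset (Fin m)) → ℝ) : Integrable f (setsLaw n P) :=
  Integrable.of_finite

lemma integral_setsLaw_prod (g : Fin n → Finset (Fin m) → ℝ) :
    ∫ D, ∏ i, g i (D i) ∂(setsLaw n P) = ∏ i, mean P (g i) := by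
  unfold setsLaw
  rw [integral_fintype_prod_eq_prod]
  simp only [mean_eq_integral]

/-- The vertices other than `v`, `u` and `w`. -/
def others (v u w : Fin n) : Finset (Fin n) := ((Finset.univ.erase v).erase u).erase w

lemma card_others {v u w : Fin n} (hu : u ≠ v) (hwv : w ≠ v) (hwu : w ≠ u) :
    (others v u w).card = n - 3 := by
  unfold others
  rw [Finset.card_erase_of_mem (by simp [hwv, hwu]), Finset.card_erase_of_mem (by simp [hu]),
    Finset.card_erase_of_mem (Finset.mem_univ v), Finset.card_univ, Fintype.card_fin]
  omega

lemma prod_univ_eq_mul_prod_others {v u w : Fin n} (hu : u ≠ v) (hwv : w ≠ v) (hwu : w ≠ u)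
    (f : Fin n → ℝ) : ∏ i, f i = f v * (f u * (f w * ∏ i ∈ others v u w, f i)) := by
  unfold others
  rw [Finset.mul_prod_erase _ _ (by simp [hwv, hwu]), Finset.mul_prod_erase _ _ (by simp [hu]),
    Finset.mul_prod_erase _ _ (Finset.mem_univ v)]

lemma ne_of_mem_others {v u w i : Fin n} (hi : i ∈ others v u w) : i ≠ v ∧ i ≠ u ∧ i ≠ w := by
  unfold others at hi
  simp only [Finset.mem_erase, Finset.mem_univ, and_true] at hi
  exact ⟨hi.2.2, hi.2.1, hi.1⟩

lemma integral_setsLaw_mul_prod {v u w : Fin n} (hu : u ≠ v) (hwv : w ≠ v) (hwu : w ≠ u)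
    (gv gu gw : Finset (Fin m) → ℝ) (h : Fin n → Finset (Fin m) → ℝ) :
    ∫ D, gv (D v) * (gu (D u) * (gw (D w) * ∏ i ∈ others v u w, h i (D i))) ∂(setsLaw n P) =
      mean P gv * (mean P gu * (mean P gw * ∏ i ∈ others v u w, mean P (h i))) := by
  let g : Fin n → Finset (Fin m) → ℝ := fun i =>
    if i = v then gv else if i = u then gu else if i = w then gw else h i
  have h1 : g v = gv := by simp [g]
  have h2 : g u = gu := by simp [g, hu]
  have h3 : g w = gw := by simp [g, hwv, hwu]
  have h4 : ∀ i ∈ others v u w, g i = h i := fun i hi => by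
    obtain ⟨a, b, c⟩ := ne_of_mem_others hi
    simp [g, a, b, c]
  have key := integral_setsLaw_prod P g
  rw [prod_univ_eq_mul_prod_others hu hwv hwu, h1, h2, h3,
    Finset.prod_congr rfl fun i hi => by rw [h4 i hi]] at key
  rw [← key]
  congr 1
  funext D
  have e : ∏ i ∈ others v u w, g i (D i) = ∏ i ∈ others v u w, h i (D i) :=
    Finset.prod_congr rfl fun i hi => by rw [h4 i hi]
  rw [prod_univ_eq_mul_prod_others hu hwv hwu, h1, h2, h3, e]

lemma mean_eq_indicator (A : Finset (Fin m)) :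
    mean P (fun X => if X = A then 1 else 0) = wt P A := by
  simp [mean]

/-- Integration over the attribute sets of three vertices and of the remaining ones separately,
when the integrand depends on the latter through a product. -/
lemma integral_setsLaw_three {v u w : Fin n} (hu : u ≠ v) (hwv : w ≠ v) (hwu : w ≠ u)
    (Φ : Finset (Fin m) → Finset (Fin m) → Finset (Fin m) → ℝ)
    (h : Fin n → Finset (Fin m) → Finset (Fin m) → ℝ) :
    ∫ D, Φ (D v) (D u) (D w) * ∏ i ∈ others v u w, h i (D v) (D i) ∂(setsLaw n P) =
      mean P fun A => (mean P fun B => mean P fun C => Φ A B C) *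
        ∏ i ∈ others v u w, mean P (h i A) := by
  have hexp : ∀ D : Fin n → Finset (Fin m),
      Φ (D v) (D u) (D w) * ∏ i ∈ others v u w, h i (D v) (D i) =
      ∑ A, ∑ B, ∑ C, Φ A B C * ((if D v = A then 1 else 0) * ((if D u = B then 1 else 0) *
        ((if D w = C then 1 else 0) * ∏ i ∈ others v u w, h i A (D i)))) := by
    intro D
    rw [Finset.sum_eq_single (D v) _ (by simp), Finset.sum_eq_single (D u) _ (by simp),
      Finset.sum_eq_single (D w) _ (by simp)]
    · simp
    · intro C _ hC; simp [hC.symm]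
    · intro B _ hB; simp [hB.symm]
    · intro A _ hA; simp [hA.symm]
  simp only [hexp]
  rw [integral_finsetSum _ fun _ _ => integrable_setsLaw P _]
  refine Finset.sum_congr rfl fun A _ => ?_
  change _ = wt P A * ((∑ B, wt P B * ∑ C, wt P C * Φ A B C) *
    ∏ i ∈ others v u w, mean P (h i A))
  rw [integral_finsetSum _ fun _ _ => integrable_setsLaw P _, Finset.sum_mul, Finset.mul_sum]
  refine Finset.sum_congr rfl fun B _ => ?_
  rw [integral_finsetSum _ fun _ _ => integrable_setsLaw P _, Finset.mul_sum, Finset.sum_mul,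
    Finset.mul_sum]
  refine Finset.sum_congr rfl fun C _ => ?_
  rw [integral_const_mul, integral_setsLaw_mul_prod P hu hwv hwu
    (fun X => if X = A then 1 else 0) (fun X => if X = B then 1 else 0)
    (fun X => if X = C then 1 else 0) (fun i => h i A)]
  simp only [mean_eq_indicator]
  ring

lemma integral_setsLaw_three_const {v u w : Fin n} (hu : u ≠ v) (hwv : w ≠ v) (hwu : w ≠ u)
    (Φ : Finset (Fin m) → Finset (Fin m) → Finset (Fin m) → ℝ) :
    ∫ D, Φ (D v) (D u) (D w) ∂(setsLaw n P) =
      mean P fun A => mean P fun B => mean P fun C => Φ A B C := by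
  have := integral_setsLaw_three P hu hwv hwu Φ fun _ _ _ => 1
  simpa [mean_const] using this

/-- The number of neighbours of `v` other than `u` and `w`. -/
def otherDeg (D : Fin n → Finset (Fin m)) (v u w : Fin n) : ℕ :=
  ((others v u w).filter fun i => s ≤ (D v ∩ D i).card).card

/-- Given the attribute sets of `v`, `u`, `w`, the number of further neighbours of `v` is
binomial. -/
lemma integral_setsLaw_otherDeg {v u w : Fin n} (hu : u ≠ v) (hwv : w ≠ v) (hwu : w ≠ u)
    (Φ : Finset (Fin m) → Finset (Fin m) → Finset (Fin m) → ℝ) (j : ℕ) :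
    ∫ D, Φ (D v) (D u) (D w) * (if otherDeg s D v u w = j then 1 else 0) ∂(setsLaw n P) =
      mean P fun A => (mean P fun B => mean P fun C => Φ A B C) *
        bin (n - 3) (edgeProb s P A) j := by
  classical
  have hexp : ∀ D : Fin n → Finset (Fin m),
      Φ (D v) (D u) (D w) * (if otherDeg s D v u w = j then 1 else 0) =
      ∑ T ∈ Finset.powersetCard j (others v u w), Φ (D v) (D u) (D w) *
        ∏ i ∈ others v u w,
          (if i ∈ T then adjInd s (D v) (D i) else 1 - adjInd s (D v) (D i)) := by
    intro D
    rw [← Finset.mul_sum]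
    congr 1
    set T₀ := (others v u w).filter fun i => s ≤ (D v ∩ D i).card with hT₀
    have hprod : ∀ T ∈ Finset.powersetCard j (others v u w), (∏ i ∈ others v u w,
        (if i ∈ T then adjInd s (D v) (D i) else 1 - adjInd s (D v) (D i))) =
        if T = T₀ then 1 else 0 := by
      intro T hT
      split_ifs with h
      · refine Finset.prod_eq_one fun i hi => ?_
        by_cases hc : s ≤ (D v ∩ D i).card <;> simp [h, hT₀, hi, adjInd, hc]
      · have hTs := (Finset.mem_powersetCard.mp hT).1
        obtain ⟨i, hi, hne⟩ : ∃ i ∈ others v u w, ¬(i ∈ T ↔ s ≤ (D v ∩ D i).card) := by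
          by_contra hcon
          push Not at hcon
          refine h (Finset.ext fun i => ?_)
          rw [hT₀, Finset.mem_filter]
          exact ⟨fun hi => ⟨hTs hi, (hcon i (hTs hi)).mp hi⟩, fun hi => (hcon i hi.1).mpr hi.2⟩
        refine Finset.prod_eq_zero hi ?_
        by_cases hc : s ≤ (D v ∩ D i).card <;> simp_all [adjInd]
    rw [Finset.sum_congr rfl hprod, Finset.sum_ite_eq']
    refine if_congr ?_ rfl rfl
    rw [Finset.mem_powersetCard]
    exact ⟨fun h => ⟨Finset.filter_subset _ _, h⟩, fun h => h.2⟩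
  simp only [hexp]
  rw [integral_finsetSum _ fun _ _ => integrable_setsLaw P _]
  have hone : ∀ T ∈ Finset.powersetCard j (others v u w),
      ∫ D, Φ (D v) (D u) (D w) * ∏ i ∈ others v u w,
        (if i ∈ T then adjInd s (D v) (D i) else 1 - adjInd s (D v) (D i)) ∂(setsLaw n P) =
      mean P fun A => (mean P fun B => mean P fun C => Φ A B C) *
        (edgeProb s P A ^ j * (1 - edgeProb s P A) ^ (n - 3 - j)) := by
    intro T hT
    rw [Finset.mem_powersetCard] at hT
    rw [integral_setsLaw_three P hu hwv hwu Φ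
      fun i A X => if i ∈ T then adjInd s A X else 1 - adjInd s A X]
    congr 1
    funext A
    congr 1
    have : ∀ i ∈ others v u w,
        mean P (fun X => if i ∈ T then adjInd s A X else 1 - adjInd s A X) =
        if i ∈ T then edgeProb s P A else 1 - edgeProb s P A := by
      intro i _
      split_ifs
      · rfl
      · rw [mean_sub, mean_const]; rfl
    rw [Finset.prod_congr rfl this, Finset.prod_ite, Finset.prod_const, Finset.prod_const,
      Finset.filter_mem_eq_inter, Finset.inter_eq_right.mpr hT.1, hT.2]
    congr 2
    rw [← Finset.sdiff_eq_filter, Finset.card_sdiff_of_subset hT.1, card_others hu hwv hwu, hT.2]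
  rw [Finset.sum_congr rfl hone, Finset.sum_const, Finset.card_powersetCard,
    card_others hu hwv hwu, nsmul_eq_mul, ← mean_const_mul]
  congr 1
  funext A
  unfold bin
  ring

lemma integral_setsLaw_otherDeg_succ {v u w : Fin n} (hu : u ≠ v) (hwv : w ≠ v) (hwu : w ≠ u)
    (Φ : Finset (Fin m) → Finset (Fin m) → Finset (Fin m) → ℝ) (j : ℕ) :
    ∫ D, Φ (D v) (D u) (D w) * (if otherDeg s D v u w + 1 = j then 1 else 0) ∂(setsLaw n P) =
      mean P fun A => (mean P fun B => mean P fun C => Φ A B C) *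
        binPrev (n - 3) (edgeProb s P A) j := by
  cases j with
  | zero => simp [binPrev, mean_const]
  | succ j =>
    simp only [Nat.add_right_cancel_iff, binPrev]
    exact integral_setsLaw_otherDeg s P hu hwv hwu Φ j

end Factorization

/-! ### Degrees and common neighbours -/

section Degrees

variable {n m : ℕ} (s : ℕ) (P : PMF (Fin (m + 1)))

lemma pairMean_eq_of_forall (hn : 2 ≤ n) (f : SimpleGraph (Fin n) → Fin n → Fin n → ℝ) (c : ℝ)
    (h : ∀ u v : Fin n, u ≠ v → ∫ D, f (graph s D) u v ∂(setsLaw n P) = c) :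
    pairMean s n P f = c := by
  unfold pairMean
  rw [integral_div, integral_finsetSum _ fun _ _ => integrable_setsLaw P _,
    Finset.sum_congr rfl fun p hp => h p.1 p.2 (Finset.mem_offDiag.mp hp).2.2, Finset.sum_const,
    Finset.offDiag_card, Finset.card_univ, Fintype.card_fin, nsmul_eq_mul]
  have hn' : (2 : ℝ) ≤ n := by exact_mod_cast hn
  have h1 : ((n * n - n : ℕ) : ℝ) = (n : ℝ) * ((n : ℝ) - 1) := by
    rw [Nat.cast_sub (Nat.le_mul_self n)]; push_cast; ring
  have h2 : (n : ℝ) * ((n : ℝ) - 1) ≠ 0 := mul_ne_zero (by positivity) (by linarith)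
  rw [h1, mul_div_cancel_left₀ _ h2]

lemma graph_adj_of_ne (D : Fin n → Finset (Fin m)) {u v : Fin n} (h : u ≠ v) :
    (graph s D).Adj u v ↔ s ≤ (D u ∩ D v).card := by
  simp [graph, h]

lemma deg_eq_card_filter (D : Fin n → Finset (Fin m)) (v : Fin n) :
    deg (graph s D) v = ((Finset.univ.erase v).filter fun i => s ≤ (D v ∩ D i).card).card := by
  unfold deg
  rw [← Set.ncard_coe_finset]
  congr 1
  ext i
  simp only [SimpleGraph.mem_neighborSet, Finset.coe_filter, Finset.mem_erase, Finset.mem_univ,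
    and_true, Set.mem_ofPred_eq]
  simp [graph, ne_comm]

lemma card_filter_eq_add_card_erase {ι : Type*} [DecidableEq ι] {t : Finset ι} {u : ι}
    (hu : u ∈ t) (p : ι → Prop) [DecidablePred p] :
    (t.filter p).card = (if p u then 1 else 0) + ((t.erase u).filter p).card := by
  rw [Finset.card_filter, Finset.card_filter]
  exact (Finset.add_sum_erase _ (fun i => if p i then 1 else 0) hu).symm

lemma deg_eq_add_otherDeg (D : Fin n → Finset (Fin m)) {v u w : Fin n} (hu : u ≠ v)
    (hwv : w ≠ v) (hwu : w ≠ u) :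
    deg (graph s D) v = (if s ≤ (D v ∩ D u).card then 1 else 0) +
      ((if s ≤ (D v ∩ D w).card then 1 else 0) + otherDeg s D v u w) := by
  rw [deg_eq_card_filter, card_filter_eq_add_card_erase (u := u) (by simp [hu]),
    card_filter_eq_add_card_erase (u := w) (by simp [hwv, hwu])]
  rfl

lemma deg_eq_sum (D : Fin n → Finset (Fin m)) {u v : Fin n} (huv : u ≠ v) :
    (deg (graph s D) u : ℝ) = adjInd s (D v) (D u) +
      ∑ w ∈ (Finset.univ.erase v).erase u, adjInd s (D u) (D w) := by
  rw [deg_eq_card_filter, Finset.card_filter, Finset.erase_right_comm, adjInd_comm s (D v),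
    ← Finset.add_sum_erase _ _ (Finset.mem_erase.mpr ⟨huv.symm, Finset.mem_univ v⟩)]
  push_cast
  rfl

lemma codeg_eq_sum (D : Fin n → Finset (Fin m)) (u v : Fin n) :
    (codeg (graph s D) u v : ℝ) =
      ∑ w ∈ (Finset.univ.erase v).erase u, adjInd s (D v) (D w) * adjInd s (D u) (D w) := by
  have h1 : codeg (graph s D) u v = (((Finset.univ.erase v).erase u).filter fun w =>
      s ≤ (D v ∩ D w).card ∧ s ≤ (D u ∩ D w).card).card := by
    unfold codeg
    rw [← Set.ncard_coe_finset]
    congr 1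
    ext i
    simp only [SimpleGraph.mem_commonNeighbors, Finset.coe_filter, Finset.mem_erase,
      Finset.mem_univ, and_true, Set.mem_ofPred_eq, graph]
    constructor
    · rintro ⟨⟨a, b⟩, c, d⟩; exact ⟨⟨a.symm, c.symm⟩, d, b⟩
    · rintro ⟨⟨a, b⟩, c, d⟩; exact ⟨⟨a.symm, d⟩, b.symm, c⟩
  rw [h1, Finset.card_filter]
  push_cast
  refine Finset.sum_congr rfl fun w _ => ?_
  unfold adjInd
  split_ifs <;> simp_all

lemma card_erase_erase {u v : Fin n} (huv : u ≠ v) :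
    ((((Finset.univ : Finset (Fin n)).erase v).erase u).card : ℝ) = (n : ℝ) - 2 := by
  have hn : 2 ≤ n := by
    have := u.2; have := v.2
    by_contra h
    exact huv (Fin.ext (by omega))
  rw [Finset.card_erase_of_mem (by simp [huv]), Finset.card_erase_of_mem (Finset.mem_univ v),
    Finset.card_univ, Fintype.card_fin, Nat.sub_sub, Nat.cast_sub hn]
  norm_num

lemma exists_third (hn : 3 ≤ n) (u v : Fin n) : ∃ w, w ≠ v ∧ w ≠ u := by
  have : ∃ w ∈ (Finset.univ : Finset (Fin n)), w ∉ ({v, u} : Finset (Fin n)) := by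
    by_contra hcon
    push Not at hcon
    have h1 := Finset.card_le_card (fun w hw => hcon w hw)
    have h2 := Finset.card_le_two (a := v) (b := u)
    rw [Finset.card_univ, Fintype.card_fin] at h1
    omega
  obtain ⟨w, _, hw⟩ := this
  simp only [Finset.mem_insert, Finset.mem_singleton, not_or] at hw
  exact ⟨w, hw⟩

/-- Averaging a sum over the possible third vertices amounts to `n - 2` times a common value. -/
lemma integral_sum_third {u v : Fin n} (huv : u ≠ v)
    (F : Fin n → (Fin n → Finset (Fin m)) → ℝ) (c : ℝ)
    (h : ∀ w, w ≠ v → w ≠ u → ∫ D, F w D ∂(setsLaw n P) = c) :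
    ∫ D, ∑ w ∈ (Finset.univ.erase v).erase u, F w D ∂(setsLaw n P) = ((n : ℝ) - 2) * c := by
  rw [integral_finsetSum _ fun _ _ => integrable_setsLaw P _,
    Finset.sum_congr rfl fun w hw => h w (by grind) (by grind), Finset.sum_const, nsmul_eq_mul,
    card_erase_erase huv]

open Classical in
lemma pairMean_adj (hn : 3 ≤ n) :
    pairMean s n P (fun G u v => if G.Adj u v then 1 else 0) = mean P (edgeProb s P) := by
  refine pairMean_eq_of_forall s P (by omega) _ _ fun u v huv => ?_
  obtain ⟨w, hwv, hwu⟩ := exists_third hn u v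
  have := integral_setsLaw_three_const P huv hwv hwu fun A B _ => adjInd s A B
  simp only [mean_const] at this
  simp only [graph_adj_of_ne s _ huv]
  refine Eq.trans ?_ this
  congr 1; funext D
  rw [adjInd_comm]; unfold adjInd
  congr

open Classical in
lemma pairMean_adj_codeg (hn : 3 ≤ n) :
    pairMean s n P (fun G u v => if G.Adj u v then (codeg G u v : ℝ) else 0) =
      ((n : ℝ) - 2) * mean P (triProb s P) := by
  refine pairMean_eq_of_forall s P (by omega) _ _ fun u v huv => ?_
  refine Eq.trans ?_ (integral_sum_third P huv
    (fun w D => adjInd s (D v) (D u) * adjInd s (D v) (D w) * adjInd s (D u) (D w)) _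
    fun w hwv hwu => integral_setsLaw_three_const P huv hwv hwu
      fun A B C => adjInd s A B * adjInd s A C * adjInd s B C)
  congr 1; funext D
  rw [codeg_eq_sum]
  simp only [mul_assoc, ← Finset.mul_sum]
  rw [adjInd_comm s (D v) (D u)]
  simp only [graph_adj_of_ne s _ huv]
  conv_rhs => rw [adjInd]
  split_ifs <;> simp

open Classical in
lemma pairMean_adj_deg (hn : 3 ≤ n) :
    pairMean s n P (fun G u v => if G.Adj u v then (deg G u : ℝ) else 0) =
      mean P (edgeProb s P) + ((n : ℝ) - 2) * mean P (pathProb s P) := by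
  refine pairMean_eq_of_forall s P (by omega) _ _ fun u v huv => ?_
  obtain ⟨w, hwv, hwu⟩ := exists_third hn u v
  have h1 := integral_setsLaw_three_const P huv hwv hwu fun A B _ => adjInd s A B
  simp only [mean_const] at h1
  have h2 := integral_sum_third P huv
    (fun w D => adjInd s (D v) (D u) * adjInd s (D u) (D w)) _
    fun w hwv hwu => integral_setsLaw_three_const P huv hwv hwu
      fun A B C => adjInd s A B * adjInd s B C
  refine Eq.trans ?_ (congrArg₂ (· + ·) h1 h2)
  rw [← integral_add (integrable_setsLaw P _) (integrable_setsLaw P _)]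
  congr 1; funext D
  rw [deg_eq_sum s D huv, ← Finset.mul_sum]
  simp only [graph_adj_of_ne s _ huv, Finset.inter_comm (D u) (D v)]
  by_cases h : s ≤ (D v ∩ D u).card
  · simp [adjInd, h]
  · simp [adjInd, h]

open Classical in
/-- Whether or not a third vertex `w` is adjacent to `v` splits the event
`u ∼ v`, `d(v) = k + 1` in two. -/
lemma indicator_adj_deg (D : Fin n → Finset (Fin m)) {v u w : Fin n} (huv : u ≠ v)
    (hwv : w ≠ v) (hwu : w ≠ u) (k : ℕ) :
    (if (graph s D).Adj u v ∧ deg (graph s D) v = k + 1 then (1 : ℝ) else 0) =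
      adjInd s (D v) (D u) * adjInd s (D v) (D w) *
        (if otherDeg s D v u w + 1 = k then 1 else 0) +
      adjInd s (D v) (D u) * (1 - adjInd s (D v) (D w)) *
        (if otherDeg s D v u w = k then 1 else 0) := by
  rw [deg_eq_add_otherDeg s D huv hwv hwu, graph_adj_of_ne s _ huv, Finset.inter_comm (D u)]
  unfold adjInd
  by_cases h1 : s ≤ (D v ∩ D u).card
  · by_cases h2 : s ≤ (D v ∩ D w).card
    · simp only [h1, h2, if_true, true_and]
      by_cases h : otherDeg s D v u w + 1 = k
      · rw [if_pos (by omega), if_pos h]; norm_num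
      · rw [if_neg (by omega), if_neg h]; norm_num
    · simp only [h1, h2, if_true, true_and, if_false]
      by_cases h : otherDeg s D v u w = k
      · rw [if_pos (by omega), if_pos h]; norm_num
      · rw [if_neg (by omega), if_neg h]; norm_num
  · simp [h1]

open Classical in
lemma pairMean_adj_degEq (hn : 3 ≤ n) (k : ℕ) :
    pairMean s n P (fun G u v => if G.Adj u v ∧ deg G v = k + 1 then 1 else 0) =
      mean P (fun A => edgeProb s P A ^ 2 * binPrev (n - 3) (edgeProb s P A) k) +
      mean P (fun A => edgeProb s P A * (1 - edgeProb s P A) *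
        bin (n - 3) (edgeProb s P A) k) := by
  refine pairMean_eq_of_forall s P (by omega) _ _ fun u v huv => ?_
  obtain ⟨w, hwv, hwu⟩ := exists_third hn u v
  have h1 := integral_setsLaw_otherDeg_succ s P huv hwv hwu
    (fun A B C => adjInd s A B * adjInd s A C) k
  have h2 := integral_setsLaw_otherDeg s P huv hwv hwu
    (fun A B C => adjInd s A B * (1 - adjInd s A C)) k
  simp only [mean_const_mul, mean_mul_const, mean_sub, mean_const] at h1 h2
  simp only [sq]
  refine Eq.trans ?_ (congrArg₂ (· + ·) h1 h2)
  rw [← integral_add (integrable_setsLaw P _) (integrable_setsLaw P _)]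
  congr 1; funext D
  rw [indicator_adj_deg s D huv hwv hwu]

open Classical in
lemma pairMean_adj_degEq_codeg (hn : 3 ≤ n) (k : ℕ) :
    pairMean s n P (fun G u v => if G.Adj u v ∧ deg G v = k + 1 then (codeg G u v : ℝ) else 0) =
      ((n : ℝ) - 2) *
        mean P (fun A => triProb s P A * binPrev (n - 3) (edgeProb s P A) k) := by
  refine pairMean_eq_of_forall s P (by omega) _ _ fun u v huv => ?_
  refine Eq.trans ?_ (integral_sum_third P huv
    (fun w D => adjInd s (D v) (D u) * adjInd s (D v) (D w) * adjInd s (D u) (D w) *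
      (if otherDeg s D v u w + 1 = k then 1 else 0)) _
    fun w hwv hwu => integral_setsLaw_otherDeg_succ s P huv hwv hwu
      (fun A B C => adjInd s A B * adjInd s A C * adjInd s B C) k)
  congr 1; funext D
  rw [codeg_eq_sum, ← mul_one (∑ w ∈ _, _), ← mul_ite_zero, Finset.sum_mul]
  refine Finset.sum_congr rfl fun w hw => ?_
  rw [indicator_adj_deg s D huv (w := w) (by grind) (by grind)]
  unfold adjInd
  split_ifs <;> simp

open Classical in
lemma pairMean_adj_degEq_deg (hn : 3 ≤ n) (k : ℕ) :
    pairMean s n P (fun G u v => if G.Adj u v ∧ deg G v = k + 1 then (deg G u : ℝ) else 0) =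
      pairMean s n P (fun G u v => if G.Adj u v ∧ deg G v = k + 1 then 1 else 0) +
      pairMean s n P
        (fun G u v => if G.Adj u v ∧ deg G v = k + 1 then (codeg G u v : ℝ) else 0) +
      ((n : ℝ) - 2) * mean P (fun A => (pathProb s P A - triProb s P A) *
        bin (n - 3) (edgeProb s P A) k) := by
  rw [pairMean_adj_degEq s P hn, pairMean_adj_degEq_codeg s P hn]
  refine pairMean_eq_of_forall s P (by omega) _ _ fun u v huv => ?_
  obtain ⟨w₀, hwv₀, hwu₀⟩ := exists_third hn u v
  have h1 := integral_setsLaw_otherDeg_succ s P huv hwv₀ hwu₀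
    (fun A B C => adjInd s A B * adjInd s A C) k
  have h2 := integral_setsLaw_otherDeg s P huv hwv₀ hwu₀
    (fun A B C => adjInd s A B * (1 - adjInd s A C)) k
  simp only [mean_const_mul, mean_mul_const, mean_sub, mean_const] at h1 h2
  have h3 := integral_sum_third P huv
    (fun w D => adjInd s (D v) (D u) * adjInd s (D v) (D w) * adjInd s (D u) (D w) *
      (if otherDeg s D v u w + 1 = k then 1 else 0)) _
    fun w hwv hwu => integral_setsLaw_otherDeg_succ s P huv hwv hwu
      (fun A B C => adjInd s A B * adjInd s A C * adjInd s B C) k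
  have h4 := integral_sum_third P huv
    (fun w D => (adjInd s (D v) (D u) * adjInd s (D u) (D w) -
        adjInd s (D v) (D u) * adjInd s (D v) (D w) * adjInd s (D u) (D w)) *
      (if otherDeg s D v u w = k then 1 else 0)) _
    fun w hwv hwu => integral_setsLaw_otherDeg s P huv hwv hwu
      (fun A B C => adjInd s A B * adjInd s B C - adjInd s A B * adjInd s A C * adjInd s B C) k
  have h5 : (fun A => (mean P fun B => mean P fun C =>
      adjInd s A B * adjInd s B C - adjInd s A B * adjInd s A C * adjInd s B C) *
        bin (n - 3) (edgeProb s P A) k) = fun A => (pathProb s P A - triProb s P A) *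
        bin (n - 3) (edgeProb s P A) k := by
    funext A
    simp only [pathProb, triProb, mean_sub]
  rw [h5] at h4
  simp only [sq]
  refine Eq.trans ?_ (congrArg₂ (· + ·) (congrArg₂ (· + ·) (congrArg₂ (· + ·) h1 h2) h3) h4)
  rw [← integral_add (integrable_setsLaw P _) (integrable_setsLaw P _),
    ← integral_add (integrable_setsLaw P _) (integrable_setsLaw P _),
    ← integral_add (integrable_setsLaw P _) (integrable_setsLaw P _)]
  congr 1; funext D
  rw [← indicator_adj_deg s D huv hwv₀ hwu₀, add_assoc, ← Finset.sum_add_distrib,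
    ← mul_one (deg (graph s D) u : ℝ), ← mul_ite_zero, deg_eq_sum s D huv, add_mul, Finset.sum_mul]
  congr 1
  · rw [graph_adj_of_ne s _ huv, Finset.inter_comm (D u)]
    unfold adjInd
    by_cases h : s ≤ (D v ∩ D u).card <;> simp [h]
  · refine Finset.sum_congr rfl fun w hw => ?_
    rw [indicator_adj_deg s D huv (w := w) (by grind) (by grind)]
    unfold adjInd
    split_ifs <;> simp

end Degrees

/-! ### The asymptotic regime -/

/-- The asymptotic regime in which all limits are taken: `(m choose s) / n → β`, the first two
moments of the number of joints converge to `α₁` and `α₂`, and its square is uniformly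
integrable. -/
structure Regime (s : ℕ) (m : ℕ → ℕ) (P : ∀ n, PMF (Fin (m n + 1))) (β α₁ α₂ : ℝ) : Prop where
  one_le : 1 ≤ s
  tendsto_m : Tendsto m atTop atTop
  beta_pos : 0 < β
  ratio : Tendsto (fun n : ℕ => ((m n).choose s : ℝ) / (n : ℝ)) atTop (𝓝 β)
  a_one : Tendsto (fun n => a s (P n) 1) atTop (𝓝 α₁)
  a_two : Tendsto (fun n => a s (P n) 2) atTop (𝓝 α₂)
  tail : ∀ ε : ℝ, 0 < ε → ∃ K : ℝ, ∀ᶠ n in atTop,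
    mean (P n) (fun A => if K < joints s A then joints s A ^ 2 else 0) ≤ ε

lemma succ_le_choose (j : ℕ) {s : ℕ} (hs : 1 ≤ s) : j + 1 ≤ (j + s).choose s := by
  induction s, hs using Nat.le_induction with
  | base => simp
  | succ s _ ih =>
    rw [← add_assoc, Nat.choose_succ_succ]
    omega

lemma bin_nonneg (N : ℕ) {q : ℝ} (h0 : 0 ≤ q) (h1 : q ≤ 1) (j : ℕ) : 0 ≤ bin N q j := by
  unfold bin
  have : 0 ≤ 1 - q := by linarith
  positivity

lemma bin_le_one (N : ℕ) {q : ℝ} (h0 : 0 ≤ q) (h1 : q ≤ 1) (j : ℕ) : bin N q j ≤ 1 := by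
  by_cases hj : j ≤ N
  · have h := add_pow q (1 - q) N
    rw [add_sub_cancel, one_pow] at h
    rw [h]
    have := Finset.single_le_sum (s := Finset.range (N + 1)) (a := j)
      (f := fun i => q ^ i * (1 - q) ^ (N - i) * (N.choose i : ℝ))
      (fun i _ => by have : 0 ≤ 1 - q := by linarith
                     positivity) (Finset.mem_range.mpr (by omega))
    refine le_trans (le_of_eq ?_) this
    unfold bin; ring
  · unfold bin
    rw [Nat.choose_eq_zero_of_lt (not_le.mp hj)]; simp

lemma binPrev_nonneg (N : ℕ) {q : ℝ} (h0 : 0 ≤ q) (h1 : q ≤ 1) (j : ℕ) : 0 ≤ binPrev N q j := by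
  cases j with
  | zero => exact le_rfl
  | succ j => exact bin_nonneg N h0 h1 j

lemma binPrev_le_one (N : ℕ) {q : ℝ} (h0 : 0 ≤ q) (h1 : q ≤ 1) (j : ℕ) : binPrev N q j ≤ 1 := by
  cases j with
  | zero => exact zero_le_one
  | succ j => exact bin_le_one N h0 h1 j

/-- The Poisson limit theorem, with `n - 3` trials. -/
lemma tendsto_bin {q : ℕ → ℝ} {r : ℝ} (h : Tendsto (fun n : ℕ => (n : ℝ) * q n) atTop (𝓝 r))
    (j : ℕ) : Tendsto (fun n => bin (n - 3) (q n) j) atTop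
      (𝓝 (r ^ j * Real.exp (-r) / (j.factorial : ℝ))) := by
  rw [← tendsto_add_atTop_iff_nat 3]
  have hq0 : Tendsto q atTop (𝓝 0) := tendsto_zero_of_tendsto_mul_atTop h
  have h' : Tendsto (fun n : ℕ => (n : ℝ) * q (n + 3)) atTop (𝓝 r) := by
    have h1 := ((tendsto_add_atTop_iff_nat 3).mpr h).sub
      (((tendsto_add_atTop_iff_nat 3).mpr hq0).const_mul 3)
    rw [mul_zero, sub_zero] at h1
    refine h1.congr fun n => ?_
    push_cast; ring
  have := tendsto_choose_mul_pow_of_tendsto_mul_atTop j h'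
  rw [mul_comm (r ^ j)]
  simpa [bin] using this

lemma tendsto_natCast_sub_two_div : Tendsto (fun n : ℕ => ((n : ℝ) - 2) / n) atTop (𝓝 1) := by
  have h := (tendsto_const_nhds (x := (1 : ℝ))).sub
    ((tendsto_natCast_atTop_atTop (R := ℝ)).const_div_atTop 2)
  rw [sub_zero] at h
  refine h.congr' ?_
  filter_upwards [eventually_gt_atTop 0] with n hn
  have : (n : ℝ) ≠ 0 := by positivity
  field_simp

/-- Passage from the scaled limits of a numerator and a denominator to the limit of a conditional
mean. -/
lemma tendsto_ratio {x y : ℕ → ℝ} {ξ υ : ℝ}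
    (hx : Tendsto (fun n : ℕ => (n : ℝ) ^ 2 * x n) atTop (𝓝 ξ))
    (hy : Tendsto (fun n : ℕ => (n : ℝ) * y n) atTop (𝓝 υ)) (hυ : υ ≠ 0) :
    Tendsto (fun n : ℕ => ((n : ℝ) - 2) * x n / y n) atTop (𝓝 (ξ / υ)) := by
  have h := tendsto_natCast_sub_two_div.mul (hx.div hy hυ)
  rw [one_mul] at h
  refine h.congr' ?_
  filter_upwards [eventually_gt_atTop 0] with n hn
  have : (n : ℝ) ≠ 0 := by positivity
  simp only [Pi.div_apply]
  field_simp

lemma eventually_ne_zero {y : ℕ → ℝ} {υ : ℝ}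
    (hy : Tendsto (fun n : ℕ => (n : ℝ) * y n) atTop (𝓝 υ)) (hυ : υ ≠ 0) :
    ∀ᶠ n in atTop, y n ≠ 0 := by
  filter_upwards [hy.eventually_ne hυ] with n hn h0
  exact hn (by rw [h0, mul_zero])

namespace Regime

variable {s : ℕ} {m : ℕ → ℕ} {P : ∀ n, PMF (Fin (m n + 1))} {β α₁ α₂ : ℝ}

/-- A vanishing property along all sequences of attribute sets of a fixed size is uniform over
all attribute sets of that size. -/
lemma eventually_forall_card (H : Regime s m P β α₁ α₂) {g : ∀ n, Finset (Fin (m n)) → ℝ} {x : ℕ}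
    (hg : ∀ A : ∀ n, Finset (Fin (m n)), (∀ᶠ n in atTop, (A n).card = x) →
      Tendsto (fun n => g n (A n)) atTop (𝓝 0)) {ε : ℝ} (hε : 0 < ε) :
    ∀ᶠ n in atTop, ∀ A : Finset (Fin (m n)), A.card = x → |g n A| < ε := by
  classical
  have hex : ∀ n, ∃ A : Finset (Fin (m n)), (x ≤ m n → A.card = x) ∧
      ((∃ B : Finset (Fin (m n)), B.card = x ∧ ε ≤ |g n B|) → ε ≤ |g n A|) := by
    intro n
    by_cases h : ∃ B : Finset (Fin (m n)), B.card = x ∧ ε ≤ |g n B|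
    · obtain ⟨B, hB, hB'⟩ := h
      exact ⟨B, fun _ => hB, fun _ => hB'⟩
    · by_cases hx : x ≤ m n
      · obtain ⟨B, -, hB⟩ := Finset.exists_subset_card_eq
          (s := (Finset.univ : Finset (Fin (m n)))) (n := x) (by simpa using hx)
        exact ⟨B, fun _ => hB, fun h' => absurd h' h⟩
      · exact ⟨∅, fun h' => absurd h' hx, fun h' => absurd h' h⟩
  choose A hA1 hA2 using hex
  have hA : ∀ᶠ n in atTop, (A n).card = x := by
    filter_upwards [H.tendsto_m.eventually_ge_atTop x] with n hn using hA1 n hn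
  have ht := (hg A hA).abs
  rw [abs_zero] at ht
  filter_upwards [ht.eventually (gt_mem_nhds hε)] with n hn B hB
  by_contra hcon
  exact absurd (hA2 n ⟨B, hB, not_lt.mp hcon⟩) (not_le.mpr hn)

/-- Dominated convergence: a function of the attribute set that is dominated by the squared number
of joints and vanishes asymptotically on sets of each fixed size has vanishing mean. -/
lemma tendsto_mean_zero (H : Regime s m P β α₁ α₂) (g : ∀ n, Finset (Fin (m n)) → ℝ) (C : ℝ)
    (hC : ∀ᶠ n in atTop, ∀ A, |g n A| ≤ C * joints s A ^ 2)
    (hg : ∀ (x : ℕ) (A : ∀ n, Finset (Fin (m n))), (∀ᶠ n in atTop, (A n).card = x) →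
      Tendsto (fun n => g n (A n)) atTop (𝓝 0)) :
    Tendsto (fun n => mean (P n) (g n)) atTop (𝓝 0) := by
  rw [Metric.tendsto_atTop']
  intro ε hε
  have hC0 : 0 < |C| + 1 := by positivity
  obtain ⟨K, hK⟩ := H.tail (ε / (4 * (|C| + 1))) (by positivity)
  obtain ⟨L, hL⟩ := exists_nat_ge K
  have hunif : ∀ᶠ n in atTop, ∀ x ∈ Finset.range (L + s), ∀ A : Finset (Fin (m n)),
      A.card = x → |g n A| < ε / 2 := by
    rw [Filter.eventually_all_finset]
    exact fun x _ => H.eventually_forall_card (hg x) (half_pos hε)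
  have hev : ∀ᶠ n in atTop, dist (mean (P n) (g n)) 0 < ε := by
    filter_upwards [hC, hK, hunif] with n h1 h2 h3
    have hpt : ∀ A, |g n A| ≤
        ε / 2 + (|C| + 1) * (if K < joints s A then joints s A ^ 2 else 0) := by
      intro A
      by_cases hA : K < joints s A
      · rw [if_pos hA]
        have : C * joints s A ^ 2 ≤ (|C| + 1) * joints s A ^ 2 :=
          mul_le_mul_of_nonneg_right (by linarith [le_abs_self C]) (sq_nonneg _)
        linarith [h1 A]
      · rw [if_neg hA, mul_zero, add_zero]
        refine (h3 A.card ?_ A rfl).le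
        rw [Finset.mem_range]
        by_contra hcon
        refine hA (hL.trans_lt ?_)
        unfold joints
        have := succ_le_choose (A.card - s) H.one_le
        rw [Nat.sub_add_cancel (by omega)] at this
        exact_mod_cast (by omega : L < A.card.choose s)
    rw [dist_zero_right, Real.norm_eq_abs]
    have hub : ∀ (f : Finset (Fin (m n)) → ℝ), (∀ A, f A ≤ |g n A|) → mean (P n) f ≤ 3 / 4 * ε := by
      intro f hf
      refine (mean_mono (P n) fun A => (hf A).trans (hpt A)).trans ?_
      rw [mean_add, mean_const, mean_const_mul]
      have : (|C| + 1) * mean (P n) (fun A => if K < joints s A then joints s A ^ 2 else 0) ≤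
          (|C| + 1) * (ε / (4 * (|C| + 1))) := mul_le_mul_of_nonneg_left h2 hC0.le
      have e : (|C| + 1) * (ε / (4 * (|C| + 1))) = ε / 4 := by field_simp
      linarith
    have hb1 := hub (g n) fun A => le_abs_self _
    have hb2 := hub (fun A => (-1) * g n A) fun A => by rw [neg_one_mul]; exact neg_le_abs _
    rw [mean_const_mul] at hb2
    rw [abs_lt]
    constructor <;> linarith
  obtain ⟨n₀, hn₀⟩ := eventually_atTop.mp hev
  exact ⟨n₀, fun n hn => hn₀ n hn.le⟩

lemma inv_ratio (H : Regime s m P β α₁ α₂) :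
    Tendsto (fun n : ℕ => (n : ℝ) / ((m n).choose s : ℝ)) atTop (𝓝 β⁻¹) := by
  refine (H.ratio.inv₀ H.beta_pos.ne').congr fun n => ?_
  rw [inv_div]

lemma errTerm_tendsto (H : Regime s m P β α₁ α₂) :
    Tendsto (fun n => errTerm s (P n)) atTop (𝓝 0) := by
  refine H.tendsto_mean_zero (fun n A => joints s A * excess s (m n) A.card) 1
    (Eventually.of_forall fun n A => ?_) fun x A hA => ?_
  · rw [abs_of_nonneg (mul_nonneg (joints_nonneg s A) (excess_nonneg s _ _)), one_mul, sq]
    exact mul_le_mul_of_nonneg_left (excess_le_joints s A) (joints_nonneg s A)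
  · have h1 : Tendsto (fun n => ((m n - s : ℕ) : ℝ)) atTop atTop :=
      tendsto_natCast_atTop_atTop.comp ((tendsto_sub_atTop_nat s).comp H.tendsto_m)
    have h2 := (h1.const_div_atTop ((x.choose s : ℝ) * ((x - s : ℕ) : ℝ))).const_mul
      (x.choose s : ℝ)
    rw [mul_zero] at h2
    refine h2.congr' ?_
    filter_upwards [hA] with n hn
    rw [joints, excess, hn]

lemma pathErr_tendsto (H : Regime s m P β α₁ α₂) :
    Tendsto (fun n => pathErr s (P n)) atTop (𝓝 0) := by
  have hnn : ∀ n (A : Finset (Fin (m n))), 0 ≤ joints s A *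
      min (joints s A * a s (P n) 1) (joints s A ^ 2 * errTerm s (P n)) := fun n A =>
    mul_nonneg (joints_nonneg s A) (le_min (mul_nonneg (joints_nonneg s A) (a_nonneg s (P n) 1))
      (mul_nonneg (sq_nonneg _) (errTerm_nonneg s (P n))))
  refine H.tendsto_mean_zero (fun n A => joints s A *
    min (joints s A * a s (P n) 1) (joints s A ^ 2 * errTerm s (P n))) (α₁ + 1) ?_ fun x A hA => ?_
  · filter_upwards [H.a_one.eventually (gt_mem_nhds (lt_add_one α₁))] with n hn A
    rw [abs_of_nonneg (hnn n A)]
    calc _ ≤ joints s A * (joints s A * a s (P n) 1) :=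
          mul_le_mul_of_nonneg_left (min_le_left _ _) (joints_nonneg s A)
      _ = a s (P n) 1 * joints s A ^ 2 := by ring
      _ ≤ _ := mul_le_mul_of_nonneg_right hn.le (sq_nonneg _)
  · have h1 := H.errTerm_tendsto.const_mul ((x.choose s : ℝ) ^ 3)
    rw [mul_zero] at h1
    refine squeeze_zero' (Eventually.of_forall fun n => hnn n (A n)) ?_ h1
    filter_upwards [hA] with n hn
    calc _ ≤ joints s (A n) * (joints s (A n) ^ 2 * errTerm s (P n)) :=
          mul_le_mul_of_nonneg_left (min_le_right _ _) (joints_nonneg s _)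
      _ = _ := by rw [joints, hn]; ring

/-! ### Limits at attribute sets of a fixed size -/

lemma edgeProb_tendsto (H : Regime s m P β α₁ α₂) {x : ℕ} {A : ∀ n, Finset (Fin (m n))}
    (hA : ∀ᶠ n in atTop, (A n).card = x) :
    Tendsto (fun n : ℕ => (n : ℝ) * edgeProb s (P n) (A n)) atTop
      (𝓝 ((x.choose s : ℝ) * (α₁ / β))) := by
  have hup : Tendsto (fun n : ℕ => (n : ℝ) / ((m n).choose s : ℝ) *
      ((x.choose s : ℝ) * a s (P n) 1)) atTop (𝓝 (β⁻¹ * ((x.choose s : ℝ) * α₁))) :=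
    H.inv_ratio.mul (H.a_one.const_mul _)
  have hlo : Tendsto (fun n : ℕ => (n : ℝ) / ((m n).choose s : ℝ) *
      ((x.choose s : ℝ) * a s (P n) 1 - (x.choose s : ℝ) ^ 2 * errTerm s (P n))) atTop
      (𝓝 (β⁻¹ * ((x.choose s : ℝ) * α₁ - (x.choose s : ℝ) ^ 2 * 0))) :=
    H.inv_ratio.mul ((H.a_one.const_mul _).sub (H.errTerm_tendsto.const_mul _))
  have e1 : β⁻¹ * ((x.choose s : ℝ) * α₁) = (x.choose s : ℝ) * (α₁ / β) := by ring
  have e2 : β⁻¹ * ((x.choose s : ℝ) * α₁ - (x.choose s : ℝ) ^ 2 * 0) =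
    (x.choose s : ℝ) * (α₁ / β) := by ring
  rw [e1] at hup
  rw [e2] at hlo
  refine tendsto_of_tendsto_of_tendsto_of_le_of_le' hlo hup ?_ ?_
  · filter_upwards [hA] with n hn
    have h := mul_le_mul_of_nonneg_left (le_edgeProb s (P n) (A n)) (Nat.cast_nonneg (α := ℝ) n)
    refine le_trans (le_of_eq ?_) h
    rw [joints, hn]; ring
  · filter_upwards [hA] with n hn
    have h := mul_le_mul_of_nonneg_left (edgeProb_le s (P n) (A n)) (Nat.cast_nonneg (α := ℝ) n)
    refine h.trans (le_of_eq ?_)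
    rw [joints, hn]; ring

lemma triProb_tendsto (H : Regime s m P β α₁ α₂) {x : ℕ} {A : ∀ n, Finset (Fin (m n))}
    (hA : ∀ᶠ n in atTop, (A n).card = x) :
    Tendsto (fun n : ℕ => (n : ℝ) ^ 2 * triProb s (P n) (A n)) atTop
      (𝓝 ((x.choose s : ℝ) * (α₁ / β) ^ 2)) := by
  have hup : Tendsto (fun n : ℕ => ((n : ℝ) / ((m n).choose s : ℝ)) ^ 2 *
      ((x.choose s : ℝ) * a s (P n) 1 ^ 2 + (x.choose s : ℝ) ^ 2 *
        ((a s (P n) 1 + a s (P n) 2) * errTerm s (P n)))) atTop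
      (𝓝 (β⁻¹ ^ 2 * ((x.choose s : ℝ) * α₁ ^ 2 + (x.choose s : ℝ) ^ 2 * ((α₁ + α₂) * 0)))) :=
    (H.inv_ratio.pow 2).mul (((H.a_one.pow 2).const_mul _).add
      (((H.a_one.add H.a_two).mul H.errTerm_tendsto).const_mul _))
  have hlo : Tendsto (fun n : ℕ => ((n : ℝ) / ((m n).choose s : ℝ)) ^ 2 *
      ((x.choose s : ℝ) * a s (P n) 1 ^ 2 - (x.choose s : ℝ) ^ 2 * errTerm s (P n) ^ 2)) atTop
      (𝓝 (β⁻¹ ^ 2 * ((x.choose s : ℝ) * α₁ ^ 2 - (x.choose s : ℝ) ^ 2 * 0 ^ 2))) :=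
    (H.inv_ratio.pow 2).mul (((H.a_one.pow 2).const_mul _).sub
      ((H.errTerm_tendsto.pow 2).const_mul _))
  have e1 : β⁻¹ ^ 2 * ((x.choose s : ℝ) * α₁ ^ 2 + (x.choose s : ℝ) ^ 2 * ((α₁ + α₂) * 0)) =
    (x.choose s : ℝ) * (α₁ / β) ^ 2 := by ring
  have e2 : β⁻¹ ^ 2 * ((x.choose s : ℝ) * α₁ ^ 2 - (x.choose s : ℝ) ^ 2 * 0 ^ 2) =
    (x.choose s : ℝ) * (α₁ / β) ^ 2 := by ring
  rw [e1] at hup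
  rw [e2] at hlo
  refine tendsto_of_tendsto_of_tendsto_of_le_of_le' hlo hup ?_ ?_
  · filter_upwards [hA] with n hn
    have h := mul_le_mul_of_nonneg_left (le_triProb s (P n) (A n)) (sq_nonneg (n : ℝ))
    refine le_trans (le_of_eq ?_) h
    rw [joints, hn]; ring
  · filter_upwards [hA] with n hn
    have h := mul_le_mul_of_nonneg_left (triProb_le s (P n) (A n)) (sq_nonneg (n : ℝ))
    refine h.trans (le_of_eq ?_)
    rw [joints, hn]; ring

lemma pathProb_tendsto (H : Regime s m P β α₁ α₂) {x : ℕ} {A : ∀ n, Finset (Fin (m n))}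
    (hA : ∀ᶠ n in atTop, (A n).card = x) :
    Tendsto (fun n : ℕ => (n : ℝ) ^ 2 * pathProb s (P n) (A n)) atTop
      (𝓝 ((x.choose s : ℝ) * (α₂ * α₁ / β ^ 2))) := by
  have hup : Tendsto (fun n : ℕ => ((n : ℝ) / ((m n).choose s : ℝ)) ^ 2 *
      ((x.choose s : ℝ) * (a s (P n) 2 * a s (P n) 1))) atTop
      (𝓝 (β⁻¹ ^ 2 * ((x.choose s : ℝ) * (α₂ * α₁)))) :=
    (H.inv_ratio.pow 2).mul ((H.a_two.mul H.a_one).const_mul _)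
  have hlo : Tendsto (fun n : ℕ => ((n : ℝ) / ((m n).choose s : ℝ)) ^ 2 *
      ((x.choose s : ℝ) * (a s (P n) 2 * a s (P n) 1) -
        (x.choose s : ℝ) ^ 2 * (errTerm s (P n) * a s (P n) 1) -
        (x.choose s : ℝ) * pathErr s (P n))) atTop
      (𝓝 (β⁻¹ ^ 2 * ((x.choose s : ℝ) * (α₂ * α₁) - (x.choose s : ℝ) ^ 2 * (0 * α₁) -
        (x.choose s : ℝ) * 0))) :=
    (H.inv_ratio.pow 2).mul ((((H.a_two.mul H.a_one).const_mul _).sub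
      ((H.errTerm_tendsto.mul H.a_one).const_mul _)).sub (H.pathErr_tendsto.const_mul _))
  have e1 : β⁻¹ ^ 2 * ((x.choose s : ℝ) * (α₂ * α₁)) =
    (x.choose s : ℝ) * (α₂ * α₁ / β ^ 2) := by ring
  have e2 : β⁻¹ ^ 2 * ((x.choose s : ℝ) * (α₂ * α₁) - (x.choose s : ℝ) ^ 2 * (0 * α₁) -
        (x.choose s : ℝ) * 0) = (x.choose s : ℝ) * (α₂ * α₁ / β ^ 2) := by ring
  rw [e1] at hup
  rw [e2] at hlo
  refine tendsto_of_tendsto_of_tendsto_of_le_of_le' hlo hup ?_ ?_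
  · filter_upwards [hA] with n hn
    have h := mul_le_mul_of_nonneg_left (le_pathProb s (P n) (A n)) (sq_nonneg (n : ℝ))
    refine le_trans (le_of_eq ?_) h
    rw [joints, hn]; ring
  · filter_upwards [hA] with n hn
    have h := mul_le_mul_of_nonneg_left (pathProb_le s (P n) (A n)) (sq_nonneg (n : ℝ))
    refine h.trans (le_of_eq ?_)
    rw [joints, hn]; ring

/-! ### Limits of the averaged probabilities -/

lemma mean_edgeProb_tendsto (H : Regime s m P β α₁ α₂) :
    Tendsto (fun n : ℕ => (n : ℝ) * mean (P n) (edgeProb s (P n))) atTop (𝓝 (α₁ ^ 2 / β)) := by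
  have hup : Tendsto (fun n : ℕ => (n : ℝ) / ((m n).choose s : ℝ) *
      (a s (P n) 1 * a s (P n) 1)) atTop (𝓝 (β⁻¹ * (α₁ * α₁))) :=
    H.inv_ratio.mul (H.a_one.mul H.a_one)
  have hlo : Tendsto (fun n : ℕ => (n : ℝ) / ((m n).choose s : ℝ) *
      (a s (P n) 1 * a s (P n) 1 - a s (P n) 2 * errTerm s (P n))) atTop
      (𝓝 (β⁻¹ * (α₁ * α₁ - α₂ * 0))) :=
    H.inv_ratio.mul ((H.a_one.mul H.a_one).sub (H.a_two.mul H.errTerm_tendsto))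
  rw [show β⁻¹ * (α₁ * α₁) = α₁ ^ 2 / β by ring] at hup
  rw [show β⁻¹ * (α₁ * α₁ - α₂ * 0) = α₁ ^ 2 / β by ring] at hlo
  refine tendsto_of_tendsto_of_tendsto_of_le_of_le hlo hup (fun n => ?_) fun n => ?_
  · have h := mean_mono (P n) fun A => le_edgeProb s (P n) A
    rw [mean_sub, mean_mul_const, mean_mul_const, ← a_one_eq_mean, ← a_eq_mean] at h
    refine le_trans (le_of_eq ?_) (mul_le_mul_of_nonneg_left h (Nat.cast_nonneg (α := ℝ) n))
    ring
  · have h := mean_mono (P n) fun A => edgeProb_le s (P n) A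
    rw [mean_mul_const, ← a_one_eq_mean] at h
    refine (mul_le_mul_of_nonneg_left h (Nat.cast_nonneg (α := ℝ) n)).trans (le_of_eq ?_)
    ring

lemma mean_triProb_tendsto (H : Regime s m P β α₁ α₂) :
    Tendsto (fun n : ℕ => (n : ℝ) ^ 2 * mean (P n) (triProb s (P n))) atTop
      (𝓝 (α₁ ^ 3 / β ^ 2)) := by
  have hup : Tendsto (fun n : ℕ => ((n : ℝ) / ((m n).choose s : ℝ)) ^ 2 *
      (a s (P n) 1 * a s (P n) 1 ^ 2 + a s (P n) 2 *
        ((a s (P n) 1 + a s (P n) 2) * errTerm s (P n)))) atTop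
      (𝓝 (β⁻¹ ^ 2 * (α₁ * α₁ ^ 2 + α₂ * ((α₁ + α₂) * 0)))) :=
    (H.inv_ratio.pow 2).mul ((H.a_one.mul (H.a_one.pow 2)).add
      (H.a_two.mul ((H.a_one.add H.a_two).mul H.errTerm_tendsto)))
  have hlo : Tendsto (fun n : ℕ => ((n : ℝ) / ((m n).choose s : ℝ)) ^ 2 *
      (a s (P n) 1 * a s (P n) 1 ^ 2 - a s (P n) 2 * errTerm s (P n) ^ 2)) atTop
      (𝓝 (β⁻¹ ^ 2 * (α₁ * α₁ ^ 2 - α₂ * 0 ^ 2))) :=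
    (H.inv_ratio.pow 2).mul ((H.a_one.mul (H.a_one.pow 2)).sub
      (H.a_two.mul (H.errTerm_tendsto.pow 2)))
  rw [show β⁻¹ ^ 2 * (α₁ * α₁ ^ 2 + α₂ * ((α₁ + α₂) * 0)) = α₁ ^ 3 / β ^ 2 by ring] at hup
  rw [show β⁻¹ ^ 2 * (α₁ * α₁ ^ 2 - α₂ * 0 ^ 2) = α₁ ^ 3 / β ^ 2 by ring] at hlo
  refine tendsto_of_tendsto_of_tendsto_of_le_of_le hlo hup (fun n => ?_) fun n => ?_
  · have h := mean_mono (P n) fun A => le_triProb s (P n) A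
    rw [mean_sub, mean_mul_const, mean_mul_const, ← a_one_eq_mean, ← a_eq_mean] at h
    refine le_trans (le_of_eq ?_) (mul_le_mul_of_nonneg_left h (sq_nonneg (n : ℝ)))
    ring
  · have h := mean_mono (P n) fun A => triProb_le s (P n) A
    rw [mean_add, mean_mul_const, mean_mul_const, ← a_one_eq_mean, ← a_eq_mean] at h
    refine (mul_le_mul_of_nonneg_left h (sq_nonneg (n : ℝ))).trans (le_of_eq ?_)
    ring

lemma mean_pathProb_tendsto (H : Regime s m P β α₁ α₂) :
    Tendsto (fun n : ℕ => (n : ℝ) ^ 2 * mean (P n) (pathProb s (P n))) atTop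
      (𝓝 (α₂ * α₁ ^ 2 / β ^ 2)) := by
  have hup : Tendsto (fun n : ℕ => ((n : ℝ) / ((m n).choose s : ℝ)) ^ 2 *
      (a s (P n) 1 * (a s (P n) 2 * a s (P n) 1))) atTop
      (𝓝 (β⁻¹ ^ 2 * (α₁ * (α₂ * α₁)))) :=
    (H.inv_ratio.pow 2).mul (H.a_one.mul (H.a_two.mul H.a_one))
  have hlo : Tendsto (fun n : ℕ => ((n : ℝ) / ((m n).choose s : ℝ)) ^ 2 *
      (a s (P n) 1 * (a s (P n) 2 * a s (P n) 1) -
        a s (P n) 2 * (errTerm s (P n) * a s (P n) 1) - a s (P n) 1 * pathErr s (P n))) atTop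
      (𝓝 (β⁻¹ ^ 2 * (α₁ * (α₂ * α₁) - α₂ * (0 * α₁) - α₁ * 0))) :=
    (H.inv_ratio.pow 2).mul (((H.a_one.mul (H.a_two.mul H.a_one)).sub
      (H.a_two.mul (H.errTerm_tendsto.mul H.a_one))).sub (H.a_one.mul H.pathErr_tendsto))
  rw [show β⁻¹ ^ 2 * (α₁ * (α₂ * α₁)) = α₂ * α₁ ^ 2 / β ^ 2 by ring] at hup
  rw [show β⁻¹ ^ 2 * (α₁ * (α₂ * α₁) - α₂ * (0 * α₁) - α₁ * 0) = α₂ * α₁ ^ 2 / β ^ 2 by ring]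
    at hlo
  refine tendsto_of_tendsto_of_tendsto_of_le_of_le hlo hup (fun n => ?_) fun n => ?_
  · have h := mean_mono (P n) fun A => le_pathProb s (P n) A
    rw [mean_sub, mean_sub, mean_mul_const, mean_mul_const, mean_mul_const, ← a_one_eq_mean,
      ← a_eq_mean] at h
    refine le_trans (le_of_eq ?_) (mul_le_mul_of_nonneg_left h (sq_nonneg (n : ℝ)))
    ring
  · have h := mean_mono (P n) fun A => pathProb_le s (P n) A
    rw [mean_mul_const, ← a_one_eq_mean] at h
    refine (mul_le_mul_of_nonneg_left h (sq_nonneg (n : ℝ))).trans (le_of_eq ?_)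
    ring

lemma h_tendsto (H : Regime s m P β α₁ α₂) (hα : α₁ ≠ 0) :
    Tendsto (fun n => h s n (P n)) atTop (𝓝 (α₁ / β)) := by
  have hβ := H.beta_pos.ne'
  have h1 := tendsto_ratio H.mean_triProb_tendsto H.mean_edgeProb_tendsto
    (div_ne_zero (pow_ne_zero 2 hα) hβ)
  rw [show α₁ ^ 3 / β ^ 2 / (α₁ ^ 2 / β) = α₁ / β by field_simp] at h1
  refine h1.congr' ?_
  filter_upwards [eventually_ge_atTop 3] with n hn
  rw [h, adjMean, pairMean_adj s (P n) hn, pairMean_adj_codeg s (P n) hn]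

lemma b_tendsto (H : Regime s m P β α₁ α₂) (hα : α₁ ≠ 0) :
    Tendsto (fun n => b s n (P n)) atTop (𝓝 (1 + α₂ / β)) := by
  have hβ := H.beta_pos.ne'
  have h0 : α₁ ^ 2 / β ≠ 0 := div_ne_zero (pow_ne_zero 2 hα) hβ
  have h1 := (tendsto_ratio H.mean_pathProb_tendsto H.mean_edgeProb_tendsto h0).const_add 1
  rw [show α₂ * α₁ ^ 2 / β ^ 2 / (α₁ ^ 2 / β) = α₂ / β by field_simp] at h1
  refine h1.congr' ?_
  filter_upwards [eventually_ge_atTop 3, eventually_ne_zero H.mean_edgeProb_tendsto h0]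
    with n hn hne
  rw [b, adjMean, pairMean_adj s (P n) hn, pairMean_adj_deg s (P n) hn, add_div, div_self hne]

end Regime

/-! ### Averages conditioned on the degree -/

/-- The size-biased Poisson weight `λ · P(Poisson(λ) = j)`. -/
noncomputable def poisBias (j : ℕ) (x : ℝ) : ℝ := x ^ (j + 1) * Real.exp (-x) / (j.factorial : ℝ)

lemma poisBias_nonneg (j : ℕ) {x : ℝ} (hx : 0 ≤ x) : 0 ≤ poisBias j x := by
  unfold poisBias; positivity

lemma continuous_poisBias (j : ℕ) : Continuous (poisBias j) := by
  unfold poisBias; fun_prop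

lemma pow_mul_exp_neg_div_le_one (j : ℕ) {x : ℝ} (hx : 0 ≤ x) :
    x ^ j * Real.exp (-x) / (j.factorial : ℝ) ≤ 1 := by
  have h := mul_le_mul_of_nonneg_right (Real.pow_div_factorial_le_exp x hx j)
    (Real.exp_pos (-x)).le
  rw [← Real.exp_add, add_neg_cancel, Real.exp_zero] at h
  refine le_trans (le_of_eq ?_) h
  ring

lemma poisBias_le_self (j : ℕ) {x : ℝ} (hx : 0 ≤ x) : poisBias j x ≤ x := by
  have h := mul_le_mul_of_nonneg_left (pow_mul_exp_neg_div_le_one j hx) hx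
  rw [mul_one] at h
  refine le_trans (le_of_eq ?_) h
  unfold poisBias; ring

lemma poisBias_le (j : ℕ) {x : ℝ} (hx : 0 ≤ x) : poisBias j x ≤ (j : ℝ) + 1 := by
  have h := mul_le_mul_of_nonneg_left (pow_mul_exp_neg_div_le_one (j + 1) hx)
    (by positivity : (0 : ℝ) ≤ (j : ℝ) + 1)
  rw [mul_one] at h
  refine le_trans (le_of_eq ?_) h
  unfold poisBias
  rw [Nat.factorial_succ]
  push_cast
  field_simp

/-- The parameter `z Z₁` of the limiting Poisson degree, as a function of the attribute set; `z` stands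
for `z₁ = E Z`. -/
noncomputable def rate (s : ℕ) (m : ℕ → ℕ) (z : ℝ) (n : ℕ) (A : Finset (Fin (m n))) : ℝ :=
  z * ((Real.sqrt ((m n).choose s))⁻¹ * Real.sqrt n * joints s A)

lemma rate_nonneg {s : ℕ} {m : ℕ → ℕ} {z : ℝ} (hz : 0 ≤ z) (n : ℕ) (A : Finset (Fin (m n))) :
    0 ≤ rate s m z n A :=
  mul_nonneg hz (mul_nonneg (by positivity) (joints_nonneg s A))

namespace Regime

variable {s : ℕ} {m : ℕ → ℕ} {P : ∀ n, PMF (Fin (m n + 1))} {β α₁ α₂ : ℝ}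

lemma sqrt_inv_ratio (H : Regime s m P β α₁ α₂) :
    Tendsto (fun n : ℕ => (Real.sqrt ((m n).choose s))⁻¹ * Real.sqrt n) atTop
      (𝓝 (Real.sqrt β)⁻¹) := by
  have h := (Real.continuous_sqrt.tendsto _).comp H.inv_ratio
  rw [Real.sqrt_inv] at h
  refine h.congr fun n => ?_
  simp only [Function.comp]
  rw [Real.sqrt_div' _ (by positivity)]
  ring

lemma rate_tendsto (H : Regime s m P β α₁ α₂) {z : ℝ} (hz : z = α₁ / Real.sqrt β) {x : ℕ}
    {A : ∀ n, Finset (Fin (m n))} (hA : ∀ᶠ n in atTop, (A n).card = x) :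
    Tendsto (fun n => rate s m z n (A n)) atTop (𝓝 ((x.choose s : ℝ) * (α₁ / β))) := by
  have h := (H.sqrt_inv_ratio.mul_const (x.choose s : ℝ)).const_mul z
  have e : z * ((Real.sqrt β)⁻¹ * (x.choose s : ℝ)) = (x.choose s : ℝ) * (α₁ / β) := by
    rw [hz]
    nth_rewrite 3 [← Real.mul_self_sqrt H.beta_pos.le]
    have := (Real.sqrt_pos.mpr H.beta_pos).ne'
    field_simp
  rw [e] at h
  refine h.congr' ?_
  filter_upwards [hA] with n hn
  rw [rate, joints, hn]

/-- A function of the attribute set that converges, on sets of fixed size, to a multiple of the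
size-biased Poisson weight has the mean that convergence in distribution of `Z₁` predicts. -/
lemma tendsto_mean_of_poisBias (H : Regime s m P β α₁ α₂) {z : ℝ} (hz : z = α₁ / Real.sqrt β)
    (hz0 : 0 ≤ z) {j : ℕ} {w : ℝ}
    (hw : Tendsto (fun n => mean (P n) fun A => poisBias j (rate s m z n A)) atTop (𝓝 w))
    (F : ∀ n, Finset (Fin (m n)) → ℝ) (C c : ℝ)
    (hC : ∀ᶠ n in atTop, ∀ A, |F n A| ≤ C * joints s A ^ 2)
    (hF : ∀ (x : ℕ) (A : ∀ n, Finset (Fin (m n))), (∀ᶠ n in atTop, (A n).card = x) →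
      Tendsto (fun n => F n (A n)) atTop (𝓝 (c * poisBias j ((x.choose s : ℝ) * (α₁ / β))))) :
    Tendsto (fun n => mean (P n) (F n)) atTop (𝓝 (c * w)) := by
  have h0 : Tendsto (fun n => mean (P n) fun A => F n A - c * poisBias j (rate s m z n A)) atTop
      (𝓝 0) := by
    refine H.tendsto_mean_zero _ (C + |c| * (z * ((Real.sqrt β)⁻¹ + 1))) ?_ fun x A hA => ?_
    · filter_upwards [hC, H.sqrt_inv_ratio.eventually (gt_mem_nhds (lt_add_one _))] with n h1 h2 A
      have hr : 0 ≤ rate s m z n A := rate_nonneg hz0 n A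
      have hb : |c * poisBias j (rate s m z n A)| ≤
          |c| * (z * ((Real.sqrt β)⁻¹ + 1)) * joints s A ^ 2 := by
        rw [abs_mul, abs_of_nonneg (poisBias_nonneg j hr), mul_assoc]
        refine mul_le_mul_of_nonneg_left ((poisBias_le_self j hr).trans ?_) (abs_nonneg c)
        rw [rate, mul_assoc z]
        exact mul_le_mul_of_nonneg_left (mul_le_mul h2.le (joints_le_sq s A) (joints_nonneg s A)
          (by positivity)) hz0
      calc _ ≤ |F n A| + |c * poisBias j (rate s m z n A)| := abs_sub _ _
        _ ≤ C * joints s A ^ 2 + |c| * (z * ((Real.sqrt β)⁻¹ + 1)) * joints s A ^ 2 :=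
          add_le_add (h1 A) hb
        _ = _ := by ring
    · have h1 := (((continuous_poisBias j).tendsto _).comp (H.rate_tendsto hz hA)).const_mul c
      have h2 := (hF x A hA).sub h1
      rwa [sub_self] at h2
  have h1 := h0.add (hw.const_mul c)
  rw [zero_add] at h1
  refine h1.congr fun n => ?_
  rw [mean_sub, mean_const_mul, sub_add_cancel]

lemma eventually_edgeProb_bound (H : Regime s m P β α₁ α₂) : ∀ᶠ n : ℕ in atTop,
    ∀ A, (n : ℝ) * edgeProb s (P n) A ≤ (β⁻¹ * α₁ + 1) * joints s A ^ 2 := by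
  filter_upwards [(H.inv_ratio.mul H.a_one).eventually (gt_mem_nhds (lt_add_one _))] with n hn A
  have hnn : 0 ≤ (n : ℝ) / ((m n).choose s : ℝ) * a s (P n) 1 :=
    mul_nonneg (by positivity) (a_nonneg s (P n) 1)
  calc (n : ℝ) * edgeProb s (P n) A
      ≤ (n : ℝ) * (joints s A * (a s (P n) 1 / ((m n).choose s : ℝ))) :=
        mul_le_mul_of_nonneg_left (edgeProb_le s (P n) A) (Nat.cast_nonneg n)
    _ = (n : ℝ) / ((m n).choose s : ℝ) * a s (P n) 1 * joints s A := by ring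
    _ ≤ _ := mul_le_mul hn.le (joints_le_sq s A) (joints_nonneg s A) (hnn.trans hn.le)

lemma eventually_pathProb_bound (H : Regime s m P β α₁ α₂) : ∀ᶠ n : ℕ in atTop,
    ∀ A, (n : ℝ) ^ 2 * pathProb s (P n) A ≤ (β⁻¹ ^ 2 * (α₂ * α₁) + 1) * joints s A ^ 2 := by
  filter_upwards [((H.inv_ratio.pow 2).mul (H.a_two.mul H.a_one)).eventually
    (gt_mem_nhds (lt_add_one _))] with n hn A
  have hnn : 0 ≤ ((n : ℝ) / ((m n).choose s : ℝ)) ^ 2 * (a s (P n) 2 * a s (P n) 1) :=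
    mul_nonneg (by positivity) (mul_nonneg (a_nonneg s (P n) 2) (a_nonneg s (P n) 1))
  calc (n : ℝ) ^ 2 * pathProb s (P n) A
      ≤ (n : ℝ) ^ 2 * (joints s A * (a s (P n) 2 * a s (P n) 1 / ((m n).choose s : ℝ) ^ 2)) :=
        mul_le_mul_of_nonneg_left (pathProb_le s (P n) A) (sq_nonneg _)
    _ = ((n : ℝ) / ((m n).choose s : ℝ)) ^ 2 * (a s (P n) 2 * a s (P n) 1) * joints s A := by ring
    _ ≤ _ := mul_le_mul hn.le (joints_le_sq s A) (joints_nonneg s A) (hnn.trans hn.le)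

/-- The case in which the reserved third vertex is a neighbour as well is negligible. -/
lemma mean_edgeProb_sq_binPrev_tendsto (H : Regime s m P β α₁ α₂) (k : ℕ) :
    Tendsto (fun n : ℕ => (n : ℝ) * mean (P n) (fun A => edgeProb s (P n) A ^ 2 *
      binPrev (n - 3) (edgeProb s (P n) A) k)) atTop (𝓝 0) := by
  have hup : Tendsto (fun n : ℕ => ((n : ℝ) / ((m n).choose s : ℝ)) ^ 2 *
      (a s (P n) 2 * a s (P n) 1 ^ 2) * (n : ℝ)⁻¹) atTop
      (𝓝 (β⁻¹ ^ 2 * (α₂ * α₁ ^ 2) * 0)) :=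
    ((H.inv_ratio.pow 2).mul (H.a_two.mul (H.a_one.pow 2))).mul tendsto_inv_atTop_nhds_zero_nat
  rw [mul_zero] at hup
  refine squeeze_zero' (Eventually.of_forall fun n => ?_) ?_ hup
  · exact mul_nonneg (Nat.cast_nonneg n) (mean_nonneg _ fun A => mul_nonneg (sq_nonneg _)
      (binPrev_nonneg _ (edgeProb_nonneg s (P n) A) (edgeProb_le_one s (P n) A) k))
  · filter_upwards [eventually_gt_atTop 0] with n hn
    have hn' : (n : ℝ) ≠ 0 := by positivity
    have h1 : ∀ A, edgeProb s (P n) A ^ 2 * binPrev (n - 3) (edgeProb s (P n) A) k ≤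
        joints s A ^ 2 * (a s (P n) 1 / ((m n).choose s : ℝ)) ^ 2 := by
      intro A
      rw [← mul_pow]
      exact (mul_le_of_le_one_right (sq_nonneg _) (binPrev_le_one _ (edgeProb_nonneg s (P n) A)
        (edgeProb_le_one s (P n) A) k)).trans
        (pow_le_pow_left₀ (edgeProb_nonneg s (P n) A) (edgeProb_le s (P n) A) 2)
    have h2 := mean_mono (P n) h1
    rw [mean_mul_const, ← a_eq_mean] at h2
    refine (mul_le_mul_of_nonneg_left h2 (Nat.cast_nonneg n)).trans (le_of_eq ?_)
    field_simp

lemma mean_edgeProb_bin_tendsto (H : Regime s m P β α₁ α₂) {z : ℝ} (hz : z = α₁ / Real.sqrt β)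
    (hz0 : 0 ≤ z) {k : ℕ} {w : ℝ}
    (hw : Tendsto (fun n => mean (P n) fun A => poisBias k (rate s m z n A)) atTop (𝓝 w)) :
    Tendsto (fun n : ℕ => (n : ℝ) * mean (P n) (fun A => edgeProb s (P n) A *
      (1 - edgeProb s (P n) A) * bin (n - 3) (edgeProb s (P n) A) k)) atTop (𝓝 w) := by
  simp only [← mean_const_mul]
  rw [← one_mul w]
  refine H.tendsto_mean_of_poisBias hz hz0 hw _ (β⁻¹ * α₁ + 1) 1 ?_ fun x A hA => ?_
  · filter_upwards [H.eventually_edgeProb_bound] with n hn A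
    have q0 := edgeProb_nonneg s (P n) A
    have q1 := edgeProb_le_one s (P n) A
    have b0 := bin_nonneg (n - 3) q0 q1 k
    have b1 := bin_le_one (n - 3) q0 q1 k
    have q2 : 0 ≤ 1 - edgeProb s (P n) A := by linarith
    rw [abs_of_nonneg (by positivity)]
    refine le_trans (mul_le_mul_of_nonneg_left ?_ (Nat.cast_nonneg n)) (hn A)
    rw [mul_assoc]
    exact mul_le_of_le_one_right q0 (mul_le_one₀ (by linarith) b0 b1)
  · have h1 := H.edgeProb_tendsto hA
    have h2 := tendsto_bin h1 k
    have h3 : Tendsto (fun n => 1 - edgeProb s (P n) (A n)) atTop (𝓝 (1 - 0)) :=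
      tendsto_const_nhds.sub (tendsto_zero_of_tendsto_mul_atTop h1)
    have h4 := (h1.mul h3).mul h2
    refine (h4.congr fun n => by ring).trans (le_of_eq ?_)
    congr 1
    unfold poisBias
    ring

lemma mean_triProb_binPrev_tendsto (H : Regime s m P β α₁ α₂) {z : ℝ}
    (hz : z = α₁ / Real.sqrt β) (hz0 : 0 ≤ z) {k : ℕ} {w : ℝ}
    (hw : Tendsto (fun n => mean (P n) fun A => poisBias k (rate s m z n A)) atTop (𝓝 w)) :
    Tendsto (fun n : ℕ => (n : ℝ) ^ 2 * mean (P n) (fun A => triProb s (P n) A *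
      binPrev (n - 3) (edgeProb s (P n) A) (k + 1))) atTop (𝓝 (α₁ / β * w)) := by
  simp only [← mean_const_mul, binPrev]
  refine H.tendsto_mean_of_poisBias hz hz0 hw _ (β⁻¹ ^ 2 * (α₂ * α₁) + 1) (α₁ / β) ?_
    fun x A hA => ?_
  · filter_upwards [H.eventually_pathProb_bound] with n hn A
    have q0 := edgeProb_nonneg s (P n) A
    have q1 := edgeProb_le_one s (P n) A
    have b0 := bin_nonneg (n - 3) q0 q1 k
    have b1 := bin_le_one (n - 3) q0 q1 k
    have t0 := triProb_nonneg s (P n) A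
    rw [abs_of_nonneg (by positivity)]
    refine le_trans (mul_le_mul_of_nonneg_left ?_ (sq_nonneg _)) (hn A)
    exact (mul_le_of_le_one_right t0 b1).trans (triProb_le_pathProb s (P n) A)
  · have h4 := (H.triProb_tendsto hA).mul (tendsto_bin (H.edgeProb_tendsto hA) k)
    refine (h4.congr fun n => by ring).trans (le_of_eq ?_)
    congr 1
    unfold poisBias
    ring

lemma mean_pathProb_sub_bin_tendsto (H : Regime s m P β α₁ α₂) {z : ℝ}
    (hz : z = α₁ / Real.sqrt β) (hz0 : 0 ≤ z) {k : ℕ} {w : ℝ}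
    (hw : Tendsto (fun n => mean (P n) fun A => poisBias k (rate s m z n A)) atTop (𝓝 w)) :
    Tendsto (fun n : ℕ => (n : ℝ) ^ 2 * mean (P n) (fun A =>
      (pathProb s (P n) A - triProb s (P n) A) * bin (n - 3) (edgeProb s (P n) A) k)) atTop
      (𝓝 ((α₂ - α₁) / β * w)) := by
  simp only [← mean_const_mul]
  refine H.tendsto_mean_of_poisBias hz hz0 hw _ (β⁻¹ ^ 2 * (α₂ * α₁) + 1) ((α₂ - α₁) / β) ?_
    fun x A hA => ?_
  · filter_upwards [H.eventually_pathProb_bound] with n hn A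
    have q0 := edgeProb_nonneg s (P n) A
    have q1 := edgeProb_le_one s (P n) A
    have b0 := bin_nonneg (n - 3) q0 q1 k
    have b1 := bin_le_one (n - 3) q0 q1 k
    have t0 := triProb_nonneg s (P n) A
    have t1 : 0 ≤ pathProb s (P n) A - triProb s (P n) A :=
      sub_nonneg.mpr (triProb_le_pathProb s (P n) A)
    rw [abs_of_nonneg (by positivity)]
    refine le_trans (mul_le_mul_of_nonneg_left ?_ (sq_nonneg _)) (hn A)
    exact (mul_le_of_le_one_right t1 b1).trans (by linarith)
  · have h4 := ((H.pathProb_tendsto hA).sub (H.triProb_tendsto hA)).mul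
      (tendsto_bin (H.edgeProb_tendsto hA) k)
    refine (h4.congr fun n => by ring).trans (le_of_eq ?_)
    congr 1
    unfold poisBias
    ring

open Classical in
lemma pairMean_adj_degEq_tendsto (H : Regime s m P β α₁ α₂) {z : ℝ} (hz : z = α₁ / Real.sqrt β)
    (hz0 : 0 ≤ z) {k : ℕ} {w : ℝ}
    (hw : Tendsto (fun n => mean (P n) fun A => poisBias k (rate s m z n A)) atTop (𝓝 w)) :
    Tendsto (fun n : ℕ => (n : ℝ) * pairMean s n (P n)
      (fun G u v => if G.Adj u v ∧ deg G v = k + 1 then 1 else 0)) atTop (𝓝 w) := by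
  have h1 := (H.mean_edgeProb_sq_binPrev_tendsto k).add (H.mean_edgeProb_bin_tendsto hz hz0 hw)
  rw [zero_add] at h1
  refine h1.congr' ?_
  filter_upwards [eventually_ge_atTop 3] with n hn
  rw [pairMean_adj_degEq s (P n) hn, mul_add]

/-- The neighbours of a vertex of degree one have no common neighbour with it. -/
lemma hDeg_one_tendsto : Tendsto (fun n => hDeg s n (P n) (0 + 1)) atTop (𝓝 0) := by
  refine tendsto_const_nhds.congr' ?_
  filter_upwards [eventually_ge_atTop 3] with n hn
  rw [hDeg, adjDegMean, pairMean_adj_degEq_codeg s (P n) hn]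
  simp [binPrev, mean_const]

lemma hDeg_tendsto (H : Regime s m P β α₁ α₂) {z : ℝ} (hz : z = α₁ / Real.sqrt β)
    (hz0 : 0 ≤ z) {k : ℕ} {w w' : ℝ} (hne : w' ≠ 0)
    (hw : Tendsto (fun n => mean (P n) fun A => poisBias k (rate s m z n A)) atTop (𝓝 w))
    (hw' : Tendsto (fun n => mean (P n) fun A => poisBias (k + 1) (rate s m z n A)) atTop
      (𝓝 w')) :
    Tendsto (fun n => hDeg s n (P n) (k + 1 + 1)) atTop (𝓝 (α₁ / β * w / w')) := by
  refine (tendsto_ratio (H.mean_triProb_binPrev_tendsto hz hz0 hw)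
    (H.pairMean_adj_degEq_tendsto hz hz0 hw') hne).congr' ?_
  filter_upwards [eventually_ge_atTop 3] with n hn
  rw [hDeg, adjDegMean, pairMean_adj_degEq_codeg s (P n) hn]

lemma bDeg_sub_hDeg_tendsto (H : Regime s m P β α₁ α₂) {z : ℝ} (hz : z = α₁ / Real.sqrt β)
    (hz0 : 0 ≤ z) {k : ℕ} {w : ℝ} (hne : w ≠ 0)
    (hw : Tendsto (fun n => mean (P n) fun A => poisBias k (rate s m z n A)) atTop (𝓝 w)) :
    Tendsto (fun n => bDeg s n (P n) (k + 1) - hDeg s n (P n) (k + 1)) atTop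
      (𝓝 (1 + (α₂ - α₁) / β)) := by
  have h0 := H.pairMean_adj_degEq_tendsto hz hz0 hw
  have h1 := (tendsto_ratio (H.mean_pathProb_sub_bin_tendsto hz hz0 hw) h0 hne).const_add 1
  rw [mul_div_assoc, div_self hne, mul_one] at h1
  refine h1.congr' ?_
  filter_upwards [eventually_ge_atTop 3, eventually_ne_zero h0 hne] with n hn hpos
  rw [bDeg, hDeg, adjDegMean, adjDegMean, pairMean_adj_degEq_deg s (P n) hn, add_div, add_div,
    div_self hpos]
  ring

end Regime

/-! ### Convergence in distribution together with second moments -/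

section Weak

variable {Ω : Type*} [MeasurableSpace Ω] {μ : Measure Ω} [IsProbabilityMeasure μ] {Z : Ω → ℝ}
  {Ω' : ℕ → Type*} [∀ n, MeasurableSpace (Ω' n)] {ν : ∀ n, Measure (Ω' n)}
  [∀ n, IsProbabilityMeasure (ν n)] {X : ∀ n, Ω' n → ℝ}

lemma tendsto_integral_comp (hX : TendstoInDistribution X atTop Z ν μ) {φ : ℝ → ℝ}
    (hφ : Continuous φ) {B : ℝ} (hB : ∀ x, |φ x| ≤ B) :
    Tendsto (fun n => ∫ x, φ (X n x) ∂(ν n)) atTop (𝓝 (∫ ω, φ (Z ω) ∂μ)) := by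
  have h := ProbabilityMeasure.tendsto_iff_forall_integral_tendsto.mp hX.tendsto
    (BoundedContinuousFunction.ofNormedAddCommGroup φ hφ B hB)
  simp only [BoundedContinuousFunction.coe_ofNormedAddCommGroup, ProbabilityMeasure.coe_mk] at h
  rw [integral_map hX.aemeasurable_limit hφ.aestronglyMeasurable] at h
  refine h.congr fun n => ?_
  rw [integral_map (hX.forall_aemeasurable n) hφ.aestronglyMeasurable]

lemma ae_nonneg_of_tendstoInDistribution (hX : TendstoInDistribution X atTop Z ν μ)
    (hnn : ∀ n x, 0 ≤ X n x) : ∀ᵐ ω ∂μ, 0 ≤ Z ω := by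
  have hcont : Continuous fun x : ℝ => min (max (-x) 0) 1 := by fun_prop
  have hbound : ∀ x : ℝ, |min (max (-x) 0) 1| ≤ 1 := fun x => by
    rw [abs_of_nonneg (le_min (le_max_right _ _) zero_le_one)]; exact min_le_right _ _
  have h := tendsto_integral_comp hX hcont hbound
  have h0 : ∀ n, ∫ x, min (max (-X n x) 0) 1 ∂(ν n) = 0 := fun n => by
    have : ∀ x, min (max (-X n x) 0) 1 = 0 := fun x => by
      rw [max_eq_right (by linarith [hnn n x])]; simp
    simp [this]
  simp only [h0] at h
  have hz : ∫ ω, min (max (-Z ω) 0) 1 ∂μ = 0 := tendsto_nhds_unique h tendsto_const_nhds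
  have hint : Integrable (fun ω => min (max (-Z ω) 0) 1) μ :=
    (integrable_const (1 : ℝ)).mono'
      (hcont.comp_aestronglyMeasurable hX.aemeasurable_limit.aestronglyMeasurable)
      (Eventually.of_forall fun ω => hbound (Z ω))
  have hpos : 0 ≤ fun ω => min (max (-Z ω) 0) 1 := fun ω => le_min (le_max_right _ _) zero_le_one
  rw [integral_eq_zero_iff_of_nonneg hpos hint] at hz
  filter_upwards [hz] with ω hω
  by_contra hneg
  have : 0 < min (max (-Z ω) 0) 1 := lt_min (lt_max_of_lt_left (by linarith)) one_pos
  simp only [Pi.zero_apply] at hω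
  linarith

lemma integrable_of_integrable_sq (hZ : AEMeasurable Z μ) (hint : Integrable (fun ω => Z ω ^ 2) μ) :
    Integrable Z μ :=
  ((memLp_two_iff_integrable_sq hZ.aestronglyMeasurable).mpr hint).integrable one_le_two

/-- Convergence of the second moments makes the squares uniformly integrable. -/
lemma exists_tail_bound (hX : TendstoInDistribution X atTop Z ν μ)
    (hint : Integrable (fun ω => Z ω ^ 2) μ) (hintX : ∀ n, Integrable (fun x => X n x ^ 2) (ν n))
    (hmom : Tendsto (fun n => ∫ x, X n x ^ 2 ∂(ν n)) atTop (𝓝 (∫ ω, Z ω ^ 2 ∂μ)))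
    {ε : ℝ} (hε : 0 < ε) :
    ∃ K : ℕ, ∀ᶠ n in atTop, ∫ x, (X n x ^ 2 - min (X n x ^ 2) K) ∂(ν n) ≤ ε := by
  have hcont : ∀ K : ℕ, Continuous fun x : ℝ => min (x ^ 2) (K : ℝ) := fun K => by fun_prop
  have hbound : ∀ (K : ℕ) (x : ℝ), |min (x ^ 2) (K : ℝ)| ≤ K := fun K x => by
    rw [abs_of_nonneg (le_min (sq_nonneg _) (Nat.cast_nonneg K))]; exact min_le_right _ _
  have hintK : ∀ K : ℕ, Integrable (fun ω => min (Z ω ^ 2) (K : ℝ)) μ := fun K =>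
    (integrable_const (K : ℝ)).mono'
      ((hcont K).comp_aestronglyMeasurable hX.aemeasurable_limit.aestronglyMeasurable)
      (Eventually.of_forall fun ω => hbound K (Z ω))
  have hintXK : ∀ (n K : ℕ), Integrable (fun x => min (X n x ^ 2) (K : ℝ)) (ν n) := fun n K =>
    (integrable_const (K : ℝ)).mono'
      ((hcont K).comp_aestronglyMeasurable (hX.forall_aemeasurable n).aestronglyMeasurable)
      (Eventually.of_forall fun x => hbound K (X n x))
  have hlim : Tendsto (fun K : ℕ => ∫ ω, (Z ω ^ 2 - min (Z ω ^ 2) (K : ℝ)) ∂μ) atTop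
      (𝓝 (∫ _, (0 : ℝ) ∂μ)) := by
    refine tendsto_integral_of_dominated_convergence (fun ω => Z ω ^ 2)
      (fun K => (hint.sub (hintK K)).aestronglyMeasurable) hint
      (fun K => Eventually.of_forall fun ω => ?_) (Eventually.of_forall fun ω => ?_)
    · rw [Real.norm_eq_abs, abs_of_nonneg (sub_nonneg.mpr (min_le_left _ _))]
      exact sub_le_self _ (le_min (sq_nonneg _) (Nat.cast_nonneg K))
    · refine tendsto_const_nhds.congr' ?_
      filter_upwards [tendsto_natCast_atTop_atTop.eventually_ge_atTop (Z ω ^ 2)] with K hK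
      rw [min_eq_left hK, sub_self]
  rw [integral_zero] at hlim
  obtain ⟨K, hK⟩ := (hlim.eventually (gt_mem_nhds (half_pos hε))).exists
  refine ⟨K, ?_⟩
  have h1 := hmom.sub (tendsto_integral_comp hX (hcont K) (hbound K))
  rw [← integral_sub hint (hintK K)] at h1
  filter_upwards [h1.eventually (gt_mem_nhds (hK.trans (half_lt_self hε)))] with n hn
  rw [integral_sub (hintX n) (hintXK n K)]
  exact hn.le

lemma sub_min_le_sq_div {x K : ℝ} (hK : 0 < K) : |x| - min |x| K ≤ x ^ 2 / K := by
  rw [le_div_iff₀ hK, ← sq_abs]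
  rcases le_total |x| K with h | h
  · rw [min_eq_left h, sub_self, zero_mul]; positivity
  · rw [min_eq_right h]; nlinarith [abs_nonneg x]

lemma abs_min_abs_le {K : ℝ} (hK : 0 < K) (x : ℝ) : |min |x| K| ≤ K := by
  rw [abs_of_nonneg (le_min (abs_nonneg _) hK.le)]; exact min_le_right _ _

/-- Truncation at level `K` changes a first moment by at most the second moment over `K`. -/
lemma abs_integral_sub_integral_min_le (hZ : AEMeasurable Z μ)
    (hint : Integrable (fun ω => Z ω ^ 2) μ) (hnn : ∀ᵐ ω ∂μ, 0 ≤ Z ω) {K : ℝ} (hK : 0 < K) :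
    |∫ ω, Z ω ∂μ - ∫ ω, min |Z ω| K ∂μ| ≤ (∫ ω, Z ω ^ 2 ∂μ) / K := by
  have hZi := integrable_of_integrable_sq hZ hint
  have hmi : Integrable (fun ω => min |Z ω| K) μ := (integrable_const K).mono'
    (Continuous.comp_aestronglyMeasurable (g := fun x : ℝ => min |x| K) (by fun_prop)
      hZ.aestronglyMeasurable) (Eventually.of_forall fun x => abs_min_abs_le hK (Z x))
  have e : ∫ ω, Z ω ∂μ = ∫ ω, |Z ω| ∂μ := integral_congr_ae (by
    filter_upwards [hnn] with ω hω using (abs_of_nonneg hω).symm)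
  rw [e, ← integral_sub hZi.abs hmi, abs_of_nonneg
    (integral_nonneg fun ω => sub_nonneg.mpr (min_le_left _ _)), ← integral_div]
  exact integral_mono (hZi.abs.sub hmi) (hint.div_const K) fun ω => sub_min_le_sq_div hK

/-- Bounded second moments make the first moments converge. -/
lemma tendsto_integral_of_sq (hX : TendstoInDistribution X atTop Z ν μ)
    (hnn : ∀ n x, 0 ≤ X n x)
    (hint : Integrable (fun ω => Z ω ^ 2) μ) (hintX : ∀ n, Integrable (fun x => X n x ^ 2) (ν n))
    (hmom : Tendsto (fun n => ∫ x, X n x ^ 2 ∂(ν n)) atTop (𝓝 (∫ ω, Z ω ^ 2 ∂μ))) :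
    Tendsto (fun n => ∫ x, X n x ∂(ν n)) atTop (𝓝 (∫ ω, Z ω ∂μ)) := by
  have hZ := ae_nonneg_of_tendstoInDistribution hX hnn
  set M := ∫ ω, Z ω ^ 2 ∂μ with hM
  have hM0 : 0 ≤ M := integral_nonneg fun ω => sq_nonneg _
  rw [Metric.tendsto_atTop']
  intro ε hε
  have hK : 0 < 3 * (M + 1) / ε := by positivity
  set K := 3 * (M + 1) / ε with hKdef
  have hMK : (M + 1) / K = ε / 3 := by rw [hKdef]; field_simp
  have hev : ∀ᶠ n in atTop, dist (∫ x, X n x ∂(ν n)) (∫ ω, Z ω ∂μ) < ε := by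
    filter_upwards [hmom.eventually (gt_mem_nhds (lt_add_one M)),
      (Metric.tendsto_nhds.mp (tendsto_integral_comp (φ := fun x => min |x| K) hX (by fun_prop)
        (abs_min_abs_le hK))) (ε / 3)
        (by positivity)] with n h1 h2
    have k1 := abs_integral_sub_integral_min_le (hX.forall_aemeasurable n) (hintX n)
      (Eventually.of_forall (hnn n)) hK
    have k2 := abs_integral_sub_integral_min_le hX.aemeasurable_limit hint hZ hK
    have k3 : (∫ x, X n x ^ 2 ∂(ν n)) / K ≤ ε / 3 := by
      rw [← hMK]; exact div_le_div_of_nonneg_right h1.le hK.le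
    have k4 : M / K < ε / 3 := by
      rw [← hMK]; exact div_lt_div_of_pos_right (lt_add_one M) hK
    rw [Real.dist_eq, abs_lt] at *
    rw [abs_le] at k1 k2
    constructor <;> linarith [k1.1, k1.2, k2.1, k2.2, h2.1, h2.2]
  obtain ⟨n₀, hn₀⟩ := eventually_atTop.mp hev
  exact ⟨n₀, fun n hn => hn₀ n hn.le⟩

end Weak

/-! ### The asymptotic degree distribution -/

section AsymptoticDegree

variable {Ω : Type*} [MeasurableSpace Ω] {μ : Measure Ω} {Z : Ω → ℝ}

lemma hasSum_descFactorial_mul_exp (i : ℕ) (x : ℝ) :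
    HasSum (fun k : ℕ => (k.descFactorial i : ℝ) *
      ((k.factorial : ℝ)⁻¹ * (x ^ k * Real.exp (-x)))) (x ^ i) := by
  have h := (NormedSpace.expSeries_div_hasSum_exp (𝔸 := ℝ) x).mul_left (x ^ i * Real.exp (-x))
  rw [← Real.exp_eq_exp_ℝ, mul_assoc, ← Real.exp_add, neg_add_cancel, Real.exp_zero, mul_one] at h
  rw [← hasSum_nat_add_iff' i, Finset.sum_eq_zero, sub_zero]
  · convert! h using 2 with k
    have hf := Nat.factorial_mul_descFactorial (Nat.le_add_left i k)
    rw [Nat.add_sub_cancel] at hf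
    have hf' : (k.factorial : ℝ) * ((k + i).descFactorial i : ℝ) = ((k + i).factorial : ℝ) := by
      exact_mod_cast hf
    rw [← hf']
    have h1 : (k.factorial : ℝ) ≠ 0 := by positivity
    have h2 : ((k + i).descFactorial i : ℝ) ≠ 0 := by
      have := Nat.descFactorial_pos.mpr (Nat.le_add_left i k)
      positivity
    field_simp
    ring
  · intro k hk
    rw [Nat.descFactorial_of_lt (Finset.mem_range.mp hk)]; simp

/-- The factorial moments of a mixed Poisson distribution are the moments of its mixing
variable. -/
lemma δbar_eq (hZ : AEMeasurable Z μ) (hnn : ∀ᵐ ω ∂μ, 0 ≤ Z ω) (hz : 0 ≤ ∫ ω, Z ω ∂μ) (i : ℕ)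
    (hi : Integrable (fun ω => Z ω ^ i) μ) :
    δbar μ Z i = (∫ ω, Z ω ∂μ) ^ i * ∫ ω, Z ω ^ i ∂μ := by
  set z := ∫ ω, Z ω ∂μ with hzdef
  let F : ℕ → Ω → ℝ := fun k ω => (k.descFactorial i : ℝ) *
    ((k.factorial : ℝ)⁻¹ * ((z * Z ω) ^ k * Real.exp (-(z * Z ω))))
  have hs : ∀ ω, HasSum (fun k => F k ω) ((z * Z ω) ^ i) := fun ω =>
    hasSum_descFactorial_mul_exp i (z * Z ω)
  have hmeas : ∀ k, AEStronglyMeasurable (F k) μ := fun k =>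
    (Continuous.comp_aestronglyMeasurable (g := fun x : ℝ => (k.descFactorial i : ℝ) *
      ((k.factorial : ℝ)⁻¹ * ((z * x) ^ k * Real.exp (-(z * x))))) (by fun_prop)
      hZ.aestronglyMeasurable)
  have h := hasSum_integral_of_dominated_convergence F hmeas
    (fun k => by
      filter_upwards [hnn] with ω hω
      rw [Real.norm_eq_abs, abs_of_nonneg]
      have : 0 ≤ z * Z ω := mul_nonneg hz hω
      positivity)
    (Eventually.of_forall fun ω => (hs ω).summable)
    (by
      simp only [(hs _).tsum_eq, mul_pow]
      exact hi.const_mul _)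
    (Eventually.of_forall hs)
  have e : ∀ k, ∫ ω, F k ω ∂μ = (k.descFactorial i : ℝ) * asympDeg μ Z k := fun k => by
    simp only [F, asympDeg, integral_const_mul, ← hzdef]
  simp only [e, mul_pow, integral_const_mul] at h
  exact h.tsum_eq

lemma δ_one_eq_δbar : δ μ Z 1 = δbar μ Z 1 := by
  unfold δ δbar
  simp

lemma integral_poisBias (j : ℕ) :
    ∫ ω, poisBias j ((∫ ω', Z ω' ∂μ) * Z ω) ∂μ = ((j : ℝ) + 1) * asympDeg μ Z (j + 1) := by
  unfold poisBias asympDeg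
  rw [integral_div, Nat.factorial_succ]
  push_cast
  field_simp

lemma integral_poisBias_pos [IsProbabilityMeasure μ] (hZ : AEMeasurable Z μ)
    (hnn : ∀ᵐ ω ∂μ, 0 ≤ Z ω) (h_pos : 0 < ∫ ω, Z ω ^ 2 ∂μ) {z : ℝ} (hz : 0 < z) (j : ℕ) :
    0 < ∫ ω, poisBias j (z * Z ω) ∂μ := by
  have h0 : 0 ≤ᵐ[μ] fun ω => poisBias j (z * Z ω) := by
    filter_upwards [hnn] with ω hω using poisBias_nonneg j (mul_nonneg hz.le hω)
  have hint : Integrable (fun ω => poisBias j (z * Z ω)) μ := by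
    refine (integrable_const ((j : ℝ) + 1)).mono' (Continuous.comp_aestronglyMeasurable
      (g := fun x : ℝ => poisBias j (z * x)) ((continuous_poisBias j).comp (by fun_prop))
      hZ.aestronglyMeasurable) ?_
    filter_upwards [hnn] with ω hω
    rw [Real.norm_eq_abs, abs_of_nonneg (poisBias_nonneg j (mul_nonneg hz.le hω))]
    exact poisBias_le j (mul_nonneg hz.le hω)
  refine lt_of_le_of_ne (integral_nonneg_of_ae h0) fun heq => ?_
  have h1 := (integral_eq_zero_iff_of_nonneg_ae h0 hint).mp heq.symm
  refine h_pos.ne' ?_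
  rw [integral_congr_ae (g := fun _ => (0 : ℝ)), integral_zero]
  filter_upwards [h1] with ω hω
  simp only [poisBias, Pi.zero_apply] at hω
  have hfac : (j.factorial : ℝ) ≠ 0 := by positivity
  have := (div_eq_zero_iff.mp hω).resolve_right hfac
  have := (mul_eq_zero.mp this).resolve_right (Real.exp_pos _).ne'
  have := (mul_eq_zero.mp (pow_eq_zero_iff (Nat.succ_ne_zero j) |>.mp this)).resolve_left hz.ne'
  rw [this]; simp

end AsymptoticDegree

/-! ### From the rescaled number of joints to the regime -/

section Rescaling

variable {s : ℕ} {m : ℕ → ℕ} {P : ∀ n, PMF (Fin (m n + 1))}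
  {Ω : Type*} [MeasurableSpace Ω] {μ : Measure Ω} [IsProbabilityMeasure μ] {Z : Ω → ℝ} {β : ℝ}

lemma Z₁_nonneg (s n m : ℕ) (x : Fin (m + 1)) : 0 ≤ Z₁ s n m x := by unfold Z₁; positivity

lemma Z₁_sq (s n m : ℕ) (x : Fin (m + 1)) :
    Z₁ s n m x ^ 2 = (n : ℝ) / (m.choose s : ℝ) * ((x : ℕ).choose s : ℝ) ^ 2 := by
  unfold Z₁
  rw [mul_pow, mul_pow, inv_pow, Real.sq_sqrt (by positivity), Real.sq_sqrt (by positivity)]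
  ring

lemma regime_of_tendstoInDistribution (hs : 1 ≤ s) (hm : Tendsto m atTop atTop)
    (h_i : TendstoInDistribution (fun n => Z₁ s n (m n)) atTop Z (fun n => (P n).toMeasure) μ)
    (h_int : Integrable (fun ω => Z ω ^ 2) μ)
    (h_mom : Tendsto (fun n => ∫ x, Z₁ s n (m n) x ^ 2 ∂(P n).toMeasure) atTop
      (𝓝 (∫ ω, Z ω ^ 2 ∂μ)))
    (hβ : 0 < β)
    (h_β : Tendsto (fun n : ℕ => ((m n).choose s : ℝ) / (n : ℝ)) atTop (𝓝 β)) :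
    Regime s m P β (Real.sqrt β * ∫ ω, Z ω ∂μ) (β * ∫ ω, Z ω ^ 2 ∂μ) := by
  have hintX : ∀ n, Integrable (fun x => Z₁ s n (m n) x ^ 2) (P n).toMeasure := fun n =>
    Integrable.of_finite
  have hpos : ∀ᶠ n : ℕ in atTop, 0 < ((m n).choose s : ℝ) ∧ 0 < (n : ℝ) := by
    filter_upwards [hm.eventually_ge_atTop s, eventually_gt_atTop 0] with n h1 h2
    exact ⟨by exact_mod_cast Nat.choose_pos h1, by exact_mod_cast h2⟩
  refine ⟨hs, hm, hβ, h_β, ?_, ?_, fun ε hε => ?_⟩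
  · have h1 := tendsto_integral_of_sq h_i (fun n x => Z₁_nonneg s n (m n) x) h_int hintX h_mom
    refine (((Real.continuous_sqrt.tendsto β).comp h_β).mul h1).congr' ?_
    filter_upwards [hpos] with n hn
    simp only [Function.comp]
    unfold a Z₁
    rw [integral_const_mul, Real.sqrt_div' _ hn.2.le]
    have e1 := (Real.sqrt_pos.mpr hn.1).ne'
    have e2 := (Real.sqrt_pos.mpr hn.2).ne'
    simp only [pow_one]
    field_simp
  · refine (h_β.mul h_mom).congr' ?_
    filter_upwards [hpos] with n hn
    simp only [Z₁_sq]
    unfold a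
    rw [integral_const_mul]
    have e1 := hn.1.ne'
    have e2 := hn.2.ne'
    field_simp
  · obtain ⟨K, hK⟩ := exists_tail_bound h_i h_int hintX h_mom
      (show 0 < ε / (4 * β) by positivity)
    refine ⟨4 * β * K, ?_⟩
    filter_upwards [hK, hpos, h_β.eventually (gt_mem_nhds (show β < 2 * β by linarith))]
      with n h1 h2 h3
    have hr : 0 < (n : ℝ) / ((m n).choose s : ℝ) := div_pos h2.2 h2.1
    have hpt : ∀ A : Finset (Fin (m n)), (if 4 * β * K < joints s A then joints s A ^ 2 else 0) ≤
        4 * β * ((n : ℝ) / ((m n).choose s : ℝ) * (A.card.choose s : ℝ) ^ 2 -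
          min ((n : ℝ) / ((m n).choose s : ℝ) * (A.card.choose s : ℝ) ^ 2) K) := by
      intro A
      set y := joints s A with hy
      change (if 4 * β * K < y then y ^ 2 else 0) ≤ 4 * β * ((n : ℝ) / ((m n).choose s : ℝ) * y ^ 2 -
          min ((n : ℝ) / ((m n).choose s : ℝ) * y ^ 2) K)
      set r := (n : ℝ) / ((m n).choose s : ℝ) with hrdef
      split_ifs with h
      · have hy2 : y ^ 2 ≤ 2 * β * (r * y ^ 2) := by
          have e : y ^ 2 = ((m n).choose s : ℝ) / (n : ℝ) * (r * y ^ 2) := by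
            rw [hrdef]
            have e1 := h2.1.ne'
            have e2 := h2.2.ne'
            field_simp
          calc y ^ 2 = ((m n).choose s : ℝ) / (n : ℝ) * (r * y ^ 2) := e
            _ ≤ _ := mul_le_mul_of_nonneg_right h3.le (by positivity)
        have hlarge : 4 * β * K < 2 * β * (r * y ^ 2) :=
          (h.trans_le (joints_le_sq s A)).trans_le hy2
        have := mul_le_mul_of_nonneg_left (min_le_right (r * y ^ 2) (K : ℝ))
          (by positivity : 0 ≤ 4 * β)
        rw [mul_sub]
        linarith
      · exact mul_nonneg (by positivity) (sub_nonneg.mpr (min_le_left _ _))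
    refine (mean_mono (P n) hpt).trans ?_
    rw [mean_const_mul, mean_card (P n) fun x => (n : ℝ) / ((m n).choose s : ℝ) *
      (x.choose s : ℝ) ^ 2 - min ((n : ℝ) / ((m n).choose s : ℝ) * (x.choose s : ℝ) ^ 2) K]
    simp only [Z₁_sq] at h1
    calc _ ≤ 4 * β * (ε / (4 * β)) := mul_le_mul_of_nonneg_left h1 (by positivity)
      _ = ε := by field_simp

lemma mean_poisBias_tendsto
    (h_i : TendstoInDistribution (fun n => Z₁ s n (m n)) atTop Z (fun n => (P n).toMeasure) μ)
    {z : ℝ} (hz : 0 ≤ z) (j : ℕ) :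
    Tendsto (fun n => mean (P n) fun A => poisBias j (rate s m z n A)) atTop
      (𝓝 (∫ ω, poisBias j (z * Z ω) ∂μ)) := by
  have hnn := ae_nonneg_of_tendstoInDistribution h_i fun n x => Z₁_nonneg s n (m n) x
  -- the weight is unbounded on the negative axis, which carries no mass
  have hcont : Continuous fun x : ℝ => poisBias j (z * |x|) :=
    (continuous_poisBias j).comp (by fun_prop)
  have hbound : ∀ x : ℝ, |poisBias j (z * |x|)| ≤ (j : ℝ) + 1 := fun x => by
    have : 0 ≤ z * |x| := by positivity
    rw [abs_of_nonneg (poisBias_nonneg j this)]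
    exact poisBias_le j this
  have h := tendsto_integral_comp h_i hcont hbound
  rw [integral_congr_ae (g := fun ω => poisBias j (z * Z ω)) (by
    filter_upwards [hnn] with ω hω
    rw [abs_of_nonneg hω])] at h
  refine h.congr fun n => ?_
  simp only [abs_of_nonneg (Z₁_nonneg s n (m n) _)]
  exact (mean_card (P n) fun x => poisBias j
    (z * ((Real.sqrt ((m n).choose s))⁻¹ * Real.sqrt n * (x.choose s : ℝ)))).symm

lemma integral_pos_of_sq (hZ : AEMeasurable Z μ) (hnn : ∀ᵐ ω ∂μ, 0 ≤ Z ω)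
    (h_int : Integrable (fun ω => Z ω ^ 2) μ) (h_pos : 0 < ∫ ω, Z ω ^ 2 ∂μ) :
    0 < ∫ ω, Z ω ∂μ := by
  refine lt_of_le_of_ne (integral_nonneg_of_ae hnn) fun heq => h_pos.ne' ?_
  have h1 := (integral_eq_zero_iff_of_nonneg_ae hnn
    (integrable_of_integrable_sq hZ h_int)).mp heq.symm
  rw [integral_congr_ae (g := fun _ => (0 : ℝ)), integral_zero]
  filter_upwards [h1] with ω hω
  rw [hω]; simp

end Rescaling

end RIG

theorem theorem2 (s k : ℕ) (hs : 1 ≤ s)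
    (m : ℕ → ℕ) (P : ∀ n, PMF (Fin (m n + 1))) (hm : Tendsto m atTop atTop)
    {Ω : Type*} [MeasurableSpace Ω] (μ : Measure Ω) [IsProbabilityMeasure μ] (Z : Ω → ℝ)
    (h_i : TendstoInDistribution (fun n => RIG.Z₁ s n (m n)) atTop Z
      (fun n => (P n).toMeasure) μ)
    (h_int : Integrable (fun ω => Z ω ^ 2) μ) (h_pos : 0 < ∫ ω, Z ω ^ 2 ∂μ)
    (h_mom : Tendsto (fun n => ∫ x, RIG.Z₁ s n (m n) x ^ 2 ∂(P n).toMeasure) atTop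
      (𝓝 (∫ ω, Z ω ^ 2 ∂μ)))
    (β : ℝ) (hβ : 0 < β)
    (h_β : Tendsto (fun n : ℕ => ((m n).choose s : ℝ) / (n : ℝ)) atTop (𝓝 β)) :
    Tendsto (fun n => RIG.b s n (P n) - (1 + RIG.a s (P n) 2 / β)) atTop (𝓝 0) ∧
    Tendsto (fun n => RIG.h s n (P n) - RIG.a s (P n) 1 / β) atTop (𝓝 0) ∧
    Tendsto (fun n => RIG.hDeg s n (P n) (k + 1) -
      RIG.a s (P n) 1 / β * ((k : ℝ) / ((k : ℝ) + 1)) *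
        (RIG.asympDeg μ Z k / RIG.asympDeg μ Z (k + 1))) atTop (𝓝 0) ∧
    Tendsto (fun n => RIG.bDeg s n (P n) (k + 1) -
      (1 + (RIG.a s (P n) 2 - RIG.a s (P n) 1) / β + RIG.hDeg s n (P n) (k + 1)))
      atTop (𝓝 0) ∧
    Tendsto (fun n => RIG.a s (P n) 1 - Real.sqrt (β * RIG.δ μ Z 1)) atTop (𝓝 0) ∧
    Tendsto (fun n => RIG.a s (P n) 2 - β * RIG.δbar μ Z 2 / RIG.δ μ Z 1) atTop (𝓝 0) := by
  have H := RIG.regime_of_tendstoInDistribution hs hm h_i h_int h_mom hβ h_β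
  have hZ := h_i.aemeasurable_limit
  have hnn := RIG.ae_nonneg_of_tendstoInDistribution h_i fun n x => RIG.Z₁_nonneg s n (m n) x
  have hz := RIG.integral_pos_of_sq hZ hnn h_int h_pos
  have hsq : 0 < Real.sqrt β := Real.sqrt_pos.mpr hβ
  have hα : Real.sqrt β * ∫ ω, Z ω ∂μ ≠ 0 := (mul_pos hsq hz).ne'
  have hz' : ∫ ω, Z ω ∂μ = (Real.sqrt β * ∫ ω, Z ω ∂μ) / Real.sqrt β := by field_simp
  have hw := fun j => RIG.mean_poisBias_tendsto h_i hz.le j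
  have hw0 := fun j => RIG.integral_poisBias_pos hZ hnn h_pos hz j
  have hδ1 : RIG.δ μ Z 1 = (∫ ω, Z ω ∂μ) ^ 2 := by
    rw [RIG.δ_one_eq_δbar, RIG.δbar_eq hZ hnn hz.le 1
      (by simpa using RIG.integrable_of_integrable_sq hZ h_int)]
    simp only [pow_one]; ring
  have hδ2 := RIG.δbar_eq hZ hnn hz.le 2 h_int
  refine ⟨?_, ?_, ?_, ?_, ?_, ?_⟩
  · have h := (H.b_tendsto hα).sub ((H.a_two.div_const β).const_add 1)
    rwa [sub_self] at h
  · have h := (H.h_tendsto hα).sub (H.a_one.div_const β)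
    rwa [sub_self] at h
  · cases k with
    | zero => simpa using RIG.Regime.hDeg_one_tendsto (s := s) (P := P)
    | succ j =>
      have h := (H.hDeg_tendsto hz' hz.le (hw0 (j + 1)).ne' (hw j) (hw (j + 1))).sub
        (((H.a_one.div_const β).mul_const (((j + 1 : ℕ) : ℝ) / (((j + 1 : ℕ) : ℝ) + 1))).mul_const
          (RIG.asympDeg μ Z (j + 1) / RIG.asympDeg μ Z (j + 1 + 1)))
      have e : ∀ c p p' : ℝ, c * (((j : ℝ) + 1) * p) / (((j + 1 : ℕ) + 1 : ℝ) * p') -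
          c * (((j + 1 : ℕ) : ℝ) / (((j + 1 : ℕ) : ℝ) + 1)) * (p / p') = 0 := by
        intro c p p'
        push_cast
        rw [mul_div_assoc c, mul_div_mul_comm, mul_assoc, sub_self]
      rwa [RIG.integral_poisBias, RIG.integral_poisBias, e] at h
  · have h := (H.bDeg_sub_hDeg_tendsto hz' hz.le (hw0 k).ne' (hw k)).sub
      (((H.a_two.sub H.a_one).div_const β).const_add 1)
    rw [sub_self] at h
    exact h.congr fun n => by ring
  · have h := H.a_one.sub_const (Real.sqrt β * ∫ ω, Z ω ∂μ)
    rw [sub_self] at h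
    rwa [hδ1, Real.sqrt_mul hβ.le, Real.sqrt_sq hz.le]
  · have h := H.a_two.sub_const (β * ∫ ω, Z ω ^ 2 ∂μ)
    rw [sub_self] at h
    rw [hδ1, hδ2]
    have e : β * ((∫ ω, Z ω ∂μ) ^ 2 * ∫ ω, Z ω ^ 2 ∂μ) / (∫ ω, Z ω ∂μ) ^ 2 =
        β * ∫ ω, Z ω ^ 2 ∂μ := by
      have := hz.ne'
      field_simp
    rwa [e]
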